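/- **Setting.** A base station with $M$ antennas and $N$ subcarriers serves $K$ users, $1\le K\le M$. The channel of a user is $\mathbf h\sim\mathcal{CN}(\mathbf 0,\mathbf C)$ in $\mathbb C^{MN}$ (the subcarrier channels $\mathbf h[n]\in\mathbb C^M$ stacked), with $\mathbf C\neq \mathbf 0$ of rank $r\ge 1$. Pilots are sent on $N_p$ distinct subcarriers $n_1,\dots,n_{N_p}$ over $T_p$ symbols, and $\beta_{\rm tr}=N_pT_p$. The pilot matrix is $\mathbf X=\sqrt{\mathsf{snr}_{\rm dl}}\,\mathbf X^{o}\in\mathbb C^{\beta_{\rm tr}\times MN}$. Here $\mathbf X^{o}$ consists of $N_p\times N$ blocks of size $T_p\times M$: the block $(\ell,n_\ell)$ has entries $\mathcal{CN}(0,1/M)$, all these entries are independent over all $\ell$, and every other block is zero. The matrix $\mathbf X^o$ does not depend on $\mathsf{snr}_{\rm dl}$. The user receives $\mathbf y^{\rm tr}=\mathbf X\mathbf h+\mathbf n^{\rm tr}$ with $\mathbf n^{\rm tr}\sim\mathcal{CN}(\mathbf 0,\mathbf I)$. **TKL scheme** with feedback dimension $\beta_{\rm fb}\le\beta_{\rm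 tr}$. Let $\mathbf X\mathbf C^{1/2}=\mathbf U\boldsymbol\Sigma\mathbf Q^{\mathsf H}$ be a singular value decomposition with singular values in descending order, and let $\mathbf S$ select the first $\beta_{\rm fb}$ of $\beta_{\rm tr}$ coordinates. For $\boldsymbol\alpha\in[0,\infty)^{\beta_{\rm fb}}$ the user sends $\mathbf z=\mathrm{diag}(\sqrt{\boldsymbol\alpha})\,\mathbf S\mathbf U^{\mathsf H}\mathbf y^{\rm tr}$. The base station receives $\mathbf y^{\rm fb}=\mathbf z+\mathbf n^{\rm ul}$ with $\mathbf n^{\rm ul}\sim\mathcal{CN}(\mathbf 0,\mathbf I)$ and forms the linear MMSE estimate $\widehat{\mathbf h}=\mathbf C_{\mathbf h\mathbf y^{\rm fb}}\mathbf C_{\mathbf y^{\rm fb}}^{-1}\mathbf y^{\rm fb}$. The vectors $\mathbf h,\mathbf n^{\rm tr},\mathbf n^{\rm ul}$ are independent, and independent of $\mathbf X^o$. For the given $\mathbf X$, the vector $\boldsymbol\alpha$ is chosen to minimize the MSE $D=\mathbb E\|\mathbf h-\widehat{\mathbf h}\|^2$ subject to $\mathbb E\|\mathbf z\|^2\le P_{\rm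 ul}=\beta_{\rm fb}\,\kappa M\,\mathsf{snr}_{\rm dl}/K$, with a fixed multiuser efficiency $\kappa\in(0,1]$ (the water-filling power allocation). **Theorem (quality scaling exponent of the TKL scheme).** If $\beta_{\rm fb}\ge r$, assume that the pilot layout resolves the channel: for at least one choice of values of the nonzero blocks of $\mathbf X^o$, the kernel of $\mathbf X^o$ meets the range of $\mathbf C$ only in $\mathbf 0$. (This is automatic if $N=1$.) Then, with probability one over $\mathbf X^{o}$, such designs $(\mathbf U,\boldsymbol\alpha)$ exist for every $\mathsf{snr}_{\rm dl}>0$ and, however they are chosen, the MSE of the TKL scheme satisfies $$D=\Theta\big(\mathsf{snr}_{\rm dl}^{-\alpha_{\rm tkl}}\big)\quad(\mathsf{snr}_{\rm dl}\to\infty),\qquad \alpha_{\rm tkl}=\begin{cases}1,&\beta_{\rm fb}\ge r,\\ 0,&\beta_{\rm fb}<r.\end{cases}$$ -/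

import Mathlib

open scoped Matrix MatrixOrder ComplexOrder Asymptotics NNReal
open MeasureTheory ProbabilityTheory Filter

noncomputable section

namespace TKL

/-! ### Circularly symmetric complex Gaussian laws -/

/-- The scalar circularly symmetric complex Gaussian law `CN(0, v)`: real and imaginary parts are
independent real Gaussians, each of mean `0` and variance `v / 2`. -/
def complexGaussian (v : ℝ≥0) : Measure ℂ :=
  ((gaussianReal 0 (v / 2)).prod (gaussianReal 0 (v / 2))).map (fun p : ℝ × ℝ => (⟨p.1, p.2⟩ : ℂ))

/-- `Z ~ CN(0, C)` for a random vector `Z` and a positive semidefinite (possibly singular) matrix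
`C`: every linear functional `tᴴ Z` has the scalar law `CN(0, tᴴ C t)`. -/
def IsCN {Ω ι : Type*} [MeasurableSpace Ω] [Fintype ι] (μ : Measure Ω) (Z : Ω → ι → ℂ)
    (C : Matrix ι ι ℂ) : Prop :=
  AEMeasurable Z μ ∧
    ∀ t : ι → ℂ, μ.map (fun ω => star t ⬝ᵥ Z ω) =
      complexGaussian (star t ⬝ᵥ (C *ᵥ t)).re.toNNReal

/-- The matrix `E[A Bᴴ]` of two random vectors (their cross-covariance, as all vectors used here
have mean zero). -/
def crossCov {Ω ι κ : Type*} [MeasurableSpace Ω] (μ : Measure Ω) (A : Ω → ι → ℂ) (B : Ω → κ → ℂ) :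
    Matrix ι κ ℂ :=
  Matrix.of fun i j => ∫ ω, A ω i * star (B ω j) ∂μ

/-! ### Downlink training -/

/-- The `β_tr × (M N)` pilot matrix, with `β_tr = N_p T_p`. Rows are grouped by probed subcarrier
(`N_p` groups of `T_p`), columns by subcarrier (`N` groups of `M`). The block in row group `ℓ` and
column group `n` is `W ℓ` when `n` is the `ℓ`-th probed subcarrier, and zero otherwise. -/
def pilotMatrix {N Np Tp M : ℕ} (probed : Fin Np ↪ Fin N)
    (W : Fin Np → Matrix (Fin Tp) (Fin M) ℂ) : Matrix (Fin (Np * Tp)) (Fin (N * M)) ℂ :=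
  Matrix.of fun i j =>
    if probed (finProdFinEquiv.symm i).1 = (finProdFinEquiv.symm j).1 then
      W (finProdFinEquiv.symm i).1 (finProdFinEquiv.symm i).2 (finProdFinEquiv.symm j).2
    else 0

/-- The training layout (probed subcarriers, `Tp` pilot symbols on each) resolves a channel with
covariance `C`: for some choice of the pilot symbols, no nonzero vector in the range of `C` (the
support of the channel) is invisible in the noiseless training measurements. -/
def Resolves {N Np M : ℕ} (Tp : ℕ) (probed : Fin Np ↪ Fin N)
    (C : Matrix (Fin (N * M)) (Fin (N * M)) ℂ) : Prop :=
  ∃ W : Fin Np → Matrix (Fin Tp) (Fin M) ℂ,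
    ∀ v : Fin (N * M) → ℂ, pilotMatrix probed W *ᵥ (C *ᵥ v) = 0 → C *ᵥ v = 0

/-- The training measurements `y = X h + n`. -/
def received {Ω : Type*} {m n : ℕ} (X : Matrix (Fin m) (Fin n) ℂ) (h : Ω → Fin n → ℂ)
    (ntr : Ω → Fin m → ℂ) (ω : Ω) : Fin m → ℂ :=
  X *ᵥ h ω + ntr ω

/-! ### The truncated Karhunen–Loève scheme -/

/-- `A = U S Qᴴ` is a singular value decomposition: `U` and `Q` are unitary and `S` is zero off its
main diagonal, which holds the (nonnegative) singular values in descending order. -/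
def IsSVD {m n : ℕ} (A : Matrix (Fin m) (Fin n) ℂ) (U : Matrix (Fin m) (Fin m) ℂ)
    (S : Matrix (Fin m) (Fin n) ℂ) (Q : Matrix (Fin n) (Fin n) ℂ) : Prop :=
  U ∈ Matrix.unitaryGroup (Fin m) ℂ ∧ Q ∈ Matrix.unitaryGroup (Fin n) ℂ ∧
    (∃ σ : ℕ → ℝ, Antitone σ ∧ (∀ i, 0 ≤ σ i) ∧
      S = Matrix.of fun (i : Fin m) (j : Fin n) => if (i : ℕ) = (j : ℕ) then (σ i : ℂ) else 0) ∧
    A = U * S * Qᴴ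

/-- The selection matrix that keeps the first `b` of `m` coordinates. -/
def selection (b m : ℕ) : Matrix (Fin b) (Fin m) ℂ :=
  Matrix.of fun (i : Fin b) (j : Fin m) => if (i : ℕ) = (j : ℕ) then 1 else 0

/-- The feedback codeword `diag(√a) S Uᴴ y`, where `y` is the training measurement. -/
def codeword {Ω : Type*} {b m n : ℕ} (X : Matrix (Fin m) (Fin n) ℂ) (h : Ω → Fin n → ℂ)
    (ntr : Ω → Fin m → ℂ) (U : Matrix (Fin m) (Fin m) ℂ) (a : Fin b → ℝ) (ω : Ω) : Fin b → ℂ :=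
  (Matrix.diagonal (fun i => ((Real.sqrt (a i) : ℝ) : ℂ)) * selection b m * Uᴴ) *ᵥ
    received X h ntr ω

/-- The feedback signal received by the base station: codeword plus uplink noise. -/
def feedback {Ω : Type*} {b m n : ℕ} (X : Matrix (Fin m) (Fin n) ℂ) (h : Ω → Fin n → ℂ)
    (ntr : Ω → Fin m → ℂ) (nul : Ω → Fin b → ℂ) (U : Matrix (Fin m) (Fin m) ℂ) (a : Fin b → ℝ)
    (ω : Ω) : Fin b → ℂ :=
  codeword X h ntr U a ω + nul ω

/-- The linear MMSE estimate `C_{hy} C_y⁻¹ y` of the channel from the received feedback. -/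
def estimate {Ω : Type*} [MeasurableSpace Ω] (μ : Measure Ω) {b m n : ℕ}
    (X : Matrix (Fin m) (Fin n) ℂ) (h : Ω → Fin n → ℂ) (ntr : Ω → Fin m → ℂ) (nul : Ω → Fin b → ℂ)
    (U : Matrix (Fin m) (Fin m) ℂ) (a : Fin b → ℝ) (ω : Ω) : Fin n → ℂ :=
  (crossCov μ h (feedback X h ntr nul U a) *
      (crossCov μ (feedback X h ntr nul U a) (feedback X h ntr nul U a))⁻¹) *ᵥ
    feedback X h ntr nul U a ω

/-- The channel estimation error `E ‖h - ĥ‖²`. -/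
def mse {Ω : Type*} [MeasurableSpace Ω] (μ : Measure Ω) {b m n : ℕ}
    (X : Matrix (Fin m) (Fin n) ℂ) (h : Ω → Fin n → ℂ) (ntr : Ω → Fin m → ℂ) (nul : Ω → Fin b → ℂ)
    (U : Matrix (Fin m) (Fin m) ℂ) (a : Fin b → ℝ) : ℝ :=
  ∫ ω, ∑ i, ‖h ω i - estimate μ X h ntr nul U a ω i‖ ^ 2 ∂μ

/-- The power allocation `a ≥ 0` meets the transmit power constraint `E ‖z‖² ≤ P`. -/
def Feasible {Ω : Type*} [MeasurableSpace Ω] (μ : Measure Ω) {b m n : ℕ}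
    (X : Matrix (Fin m) (Fin n) ℂ) (h : Ω → Fin n → ℂ) (ntr : Ω → Fin m → ℂ) (P : ℝ)
    (U : Matrix (Fin m) (Fin m) ℂ) (a : Fin b → ℝ) : Prop :=
  (∀ i, 0 ≤ a i) ∧ ∫ ω, ∑ i, ‖codeword X h ntr U a ω i‖ ^ 2 ∂μ ≤ P

/-- `(U, a)` is a TKL design: `U` collects the left singular vectors of `X C^{1/2}`, ordered by
descending singular values, and `a` minimizes the channel estimation error among all power
allocations that meet the power constraint. -/
def IsDesign {Ω : Type*} [MeasurableSpace Ω] (μ : Measure Ω) {b m n : ℕ}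
    (X : Matrix (Fin m) (Fin n) ℂ) (C : Matrix (Fin n) (Fin n) ℂ) (h : Ω → Fin n → ℂ)
    (ntr : Ω → Fin m → ℂ) (nul : Ω → Fin b → ℂ) (P : ℝ)
    (U : Matrix (Fin m) (Fin m) ℂ) (a : Fin b → ℝ) : Prop :=
  (∃ S Q, IsSVD (X * CFC.sqrt C) U S Q) ∧ Feasible μ X h ntr P U a ∧
    ∀ a' : Fin b → ℝ, Feasible μ X h ntr P U a' →
      mse μ X h ntr nul U a ≤ mse μ X h ntr nul U a'

/-- The pilot matrix at downlink SNR `snr`: `√snr` times the normalized pilot matrix. -/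
def scaledPilot {N Np Tp M : ℕ} (probed : Fin Np ↪ Fin N)
    (W : Fin Np → Matrix (Fin Tp) (Fin M) ℂ) (snr : ℝ) :
    Matrix (Fin (Np * Tp)) (Fin (N * M)) ℂ :=
  ((Real.sqrt snr : ℝ) : ℂ) • pilotMatrix probed W

/-- The effective uplink power `β_fb κ M snr_ul`, where `snr_ul = snr_dl / K`. -/
def uplinkPower (b M K : ℕ) (κ snr : ℝ) : ℝ :=
  b * κ * M * (snr / K)

end TKL

end

/-! ### Linear algebra -/

namespace Matrix

/-! For fixed pilots only second moments matter. With `L = √C`, encoder `F` and linear estimator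
`A`, the error is `‖L - A F X L‖² + ‖A F‖² + ‖A‖²` in Frobenius norms: lost channel, downlink noise,
uplink noise (`re_trace_errCov`). The LMMSE estimator minimizes this over `A`. A lower bound
therefore has to hold for all `A` and `F`, while an upper bound needs one estimator and one feasible
power allocation.

Lower bounds. Splitting `L = (L - A F X L) + (A F)(X L)` shows that lost channel and downlink noise
cannot both be small; as `X` grows like `√snr`, the error is at least of order `1/snr`. If `bfb <
rank C`, then `A F X L` has rank below that of `L`, and a matrix keeps a positive distance from all
matrices of smaller rank, so the error does not decay.

Upper bounds. The zero estimator gives `tr C`. If `rank C ≤ bfb`, the truncation to `bfb` left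
singular vectors discards only zero singular values, hence keeps the Gram matrix of `X L`
(`IsSVD.gram_selection`). If moreover the pilots are injective on the range of `C`, then `L` is a
left multiple of this Gram matrix, and zero forcing removes the first error term. A constant
allocation `t`, independent of the SNR, is feasible because the power budget also grows linearly;
both noise terms are then `O(1/snr)`. An optimal allocation does at least as well, so the
water-filling formula is never needed.

Injectivity on the range of `C` follows from the nonvanishing of a determinant polynomial in the
pilot symbols. One resolving choice makes this polynomial nonzero, and independent atomless entries
avoid its zero set almost surely (`ae_resolves`). Designs exist because a continuous error is
minimized over a compact feasible set. -/

theorem exists_mul_eq_of_ker_le {K l m n : Type*} [Field K] [Fintype m]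
    [Fintype n] [DecidableEq n] [DecidableEq m] (A : Matrix m n K) (B : Matrix l n K)
    (h : ∀ v, A *ᵥ v = 0 → B *ᵥ v = 0) : ∃ R : Matrix l m K, R * A = B := by
  -- `g` is a linear section of `A` on its range. The map `B ∘ g` extends to the whole space, and
  -- the kernel condition makes the choice of preimage irrelevant.
  obtain ⟨g, hg⟩ := (A.mulVecLin.rangeRestrict).exists_rightInverse_of_surjective
    (LinearMap.range_rangeRestrict _)
  obtain ⟨f, hf⟩ := LinearMap.exists_extend (B.mulVecLin ∘ₗ g)
  refine ⟨LinearMap.toMatrix' f, Matrix.ext_of_mulVec_single fun j => ?_⟩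
  rw [← Matrix.mulVec_mulVec, LinearMap.toMatrix'_mulVec]
  set v : n → K := Pi.single j 1
  have h1 : f (A *ᵥ v) = B *ᵥ g (A.mulVecLin.rangeRestrict v) :=
    LinearMap.congr_fun hf (A.mulVecLin.rangeRestrict v)
  have h2 : A *ᵥ g (A.mulVecLin.rangeRestrict v) = A *ᵥ v :=
    congrArg Subtype.val (LinearMap.congr_fun hg (A.mulVecLin.rangeRestrict v))
  rw [h1, ← sub_eq_zero, ← Matrix.mulVec_sub]
  apply h
  rw [Matrix.mulVec_sub, h2, sub_self]

/-- A generalized inverse: any linear extension of a section of `C` over its range. -/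
theorem exists_mul_mul_self_eq {K n : Type*} [Field K] [Fintype n] [DecidableEq n]
    (C : Matrix n n K) : ∃ J : Matrix n n K, C * J * C = C := by
  obtain ⟨g, hg⟩ := (C.mulVecLin.rangeRestrict).exists_rightInverse_of_surjective
    (LinearMap.range_rangeRestrict _)
  obtain ⟨f, hf⟩ := LinearMap.exists_extend g
  refine ⟨LinearMap.toMatrix' f, Matrix.ext_of_mulVec_single fun j => ?_⟩
  rw [← Matrix.mulVec_mulVec, ← Matrix.mulVec_mulVec, LinearMap.toMatrix'_mulVec]
  set v : n → K := Pi.single j 1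
  have h1 : f (C *ᵥ v) = g (C.mulVecLin.rangeRestrict v) :=
    LinearMap.congr_fun hf (C.mulVecLin.rangeRestrict v)
  have h2 : C *ᵥ g (C.mulVecLin.rangeRestrict v) = C *ᵥ v :=
    congrArg Subtype.val (LinearMap.congr_fun hg (C.mulVecLin.rangeRestrict v))
  rw [h1, h2]

theorem sqrt_mul_sqrt {n : Type*} [Fintype n] [DecidableEq n] {C : Matrix n n ℂ}
    (hC : C.PosSemidef) : CFC.sqrt C * CFC.sqrt C = C :=
  CFC.sqrt_mul_sqrt_self C hC.nonneg

theorem isHermitian_sqrt {n : Type*} [Fintype n] [DecidableEq n] (C : Matrix n n ℂ) :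
    (CFC.sqrt C).IsHermitian :=
  (Matrix.nonneg_iff_posSemidef.mp (CFC.sqrt_nonneg C)).isHermitian

theorem rank_of_isHermitian_of_mul_self {n : Type*} [Fintype n] [DecidableEq n]
    {C L : Matrix n n ℂ} (hL : L.IsHermitian) (hLL : L * L = C) : L.rank = C.rank := by
  rw [← hLL]
  nth_rewrite 2 [← hL.eq]
  rw [Matrix.rank_conjTranspose_mul_self]

theorem re_trace_mul_conjTranspose {m n : Type*} [Fintype m] [Fintype n]
    (A : Matrix m n ℂ) : (A * Aᴴ).trace.re = ∑ i, ∑ j, ‖A i j‖ ^ 2 := by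
  simp [Matrix.trace, Matrix.mul_apply, Complex.normSq_apply, ← Complex.normSq_eq_norm_sq]

section Frobenius
open scoped Matrix.Norms.Frobenius

theorem frobenius_norm_sq {m n : Type*} [Fintype m] [Fintype n]
    (A : Matrix m n ℂ) : ‖A‖ ^ 2 = (A * Aᴴ).trace.re := by
  rw [re_trace_mul_conjTranspose, Matrix.frobenius_norm_def, ← Real.sqrt_eq_rpow, Real.sq_sqrt]
  · norm_cast
  · positivity

/-- A matrix stays away from all matrices of smaller rank. -/
theorem exists_pos_forall_rank_lt_le_norm_sub {n : Type*} [Fintype n] [DecidableEq n]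
    (L : Matrix n n ℂ) : ∃ c : ℝ, 0 < c ∧ ∀ T : Matrix n n ℂ, T.rank < L.rank → c ≤ ‖L - T‖ := by
  obtain ⟨J, hJ⟩ := L.exists_mul_mul_self_eq
  refine ⟨(‖J‖ + 1)⁻¹, by positivity, fun T hT => ?_⟩
  -- The rank of `T J L` is below that of `L`, so its kernel cannot lie in the kernel of `L`. For
  -- such a `w`, `L - T` maps `J L w` back to `L w`, which forces `‖L - T‖ ‖J‖ ≥ 1`.
  have hw : ∃ w : n → ℂ, (T * J * L) *ᵥ w = 0 ∧ L *ᵥ w ≠ 0 := by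
    by_contra! hcon
    obtain ⟨R, hR⟩ := exists_mul_eq_of_ker_le (T * J * L) L hcon
    have h1 : L.rank ≤ T.rank := by
      rw [← hR]
      refine (Matrix.rank_mul_le_right _ _).trans ?_
      rw [Matrix.mul_assoc]
      exact Matrix.rank_mul_le_left _ _
    omega
  obtain ⟨w, hw1, hw2⟩ := hw
  set W : Matrix n Unit ℂ := Matrix.replicateCol Unit w
  have hW1 : T * J * L * W = 0 := by
    ext i j; simpa [W, Matrix.mul_apply, Matrix.mulVec, dotProduct] using congrFun hw1 i
  have hW2 : L * W ≠ 0 := by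
    intro h0
    apply hw2
    ext i
    simpa [W, Matrix.mul_apply, Matrix.mulVec, dotProduct] using congrFun (congrFun h0 i) ()
  have key : (L - T) * (J * (L * W)) = L * W := by
    have h2 : L * (J * (L * W)) = L * W := by
      rw [← Matrix.mul_assoc, ← Matrix.mul_assoc, hJ]
    rw [Matrix.sub_mul, h2, ← Matrix.mul_assoc, ← Matrix.mul_assoc, hW1, sub_zero]
  have hpos : 0 < ‖L * W‖ := norm_pos_iff.mpr hW2
  have h3 : ‖L * W‖ ≤ ‖L - T‖ * (‖J‖ * ‖L * W‖) := by
    calc ‖L * W‖ = ‖(L - T) * (J * (L * W))‖ := by rw [key]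
      _ ≤ ‖L - T‖ * ‖J * (L * W)‖ := Matrix.frobenius_norm_mul _ _
      _ ≤ _ := by gcongr; exact Matrix.frobenius_norm_mul _ _
  have h4 : 1 ≤ ‖L - T‖ * ‖J‖ := by
    rw [← mul_assoc] at h3
    exact le_of_mul_le_mul_right (by linarith) hpos
  rw [inv_le_iff_one_le_mul₀ (by positivity)]
  nlinarith [norm_nonneg (L - T)]

end Frobenius

end Matrix

/-! ### Error covariances of linear estimators, and lower bounds on the error -/

namespace TKL

variable {b m n : Type*} [Fintype b] [Fintype m] [Fintype n]

/-- The covariance of `F (X h + n) + u` for `h` of covariance `C` and white noises `n`, `u`. -/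
def obsCov [DecidableEq b] [DecidableEq m] (X : Matrix m n ℂ) (C : Matrix n n ℂ)
    (F : Matrix b m ℂ) : Matrix b b ℂ :=
  F * (X * C * Xᴴ + 1) * Fᴴ + 1

/-- The error covariance of the linear estimator `A` of `h` from `F (X h + n) + u`. -/
def errCov [DecidableEq n] (X : Matrix m n ℂ) (C : Matrix n n ℂ) (F : Matrix b m ℂ)
    (A : Matrix n b ℂ) : Matrix n n ℂ :=
  (1 - A * F * X) * C * (1 - A * F * X)ᴴ + A * F * (A * F)ᴴ + A * Aᴴ

/-- The linear MMSE estimator of `h` from `F (X h + n) + u`. -/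
noncomputable def lmmse [DecidableEq b] [DecidableEq m] (X : Matrix m n ℂ)
    (C : Matrix n n ℂ) (F : Matrix b m ℂ) : Matrix n b ℂ :=
  C * Xᴴ * Fᴴ * (obsCov X C F)⁻¹

theorem obsCov_posDef [DecidableEq b] [DecidableEq m]
    (X : Matrix m n ℂ) {C : Matrix n n ℂ} (hC : C.PosSemidef)
    (F : Matrix b m ℂ) : (obsCov X C F).PosDef :=
  Matrix.PosDef.posSemidef_add
    (((hC.mul_mul_conjTranspose_same X).add Matrix.PosSemidef.one).mul_mul_conjTranspose_same F)
    Matrix.PosDef.one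

/-- Completing the square: the error is quadratic in `A` with leading matrix `obsCov`, and `lmmse`
solves the normal equation `h1`. -/
theorem errCov_eq [DecidableEq b] [DecidableEq m] [DecidableEq n]
    (X : Matrix m n ℂ) {C : Matrix n n ℂ} (hC : C.PosSemidef) (F : Matrix b m ℂ)
    (A : Matrix n b ℂ) :
    errCov X C F A = errCov X C F (lmmse X C F) +
      (A - lmmse X C F) * obsCov X C F * (A - lmmse X C F)ᴴ := by
  have hV := (obsCov_posDef X hC F)
  have hdet : IsUnit (obsCov X C F).det := (Matrix.isUnit_iff_isUnit_det _).mp hV.isUnit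
  have h1 : lmmse X C F * obsCov X C F = C * Xᴴ * Fᴴ := by
    rw [lmmse, Matrix.mul_assoc, Matrix.nonsing_inv_mul _ hdet, Matrix.mul_one]
  have h2 : obsCov X C F * (lmmse X C F)ᴴ = F * X * C := by
    have := congrArg Matrix.conjTranspose h1
    simpa [Matrix.conjTranspose_mul, hV.isHermitian.eq, hC.isHermitian.eq, Matrix.mul_assoc]
      using this
  have expand : ∀ A' : Matrix n b ℂ, errCov X C F A' =
      C - A' * (F * X * C) - (C * Xᴴ * Fᴴ) * A'ᴴ + A' * obsCov X C F * A'ᴴ := by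
    intro A'
    simp only [errCov, obsCov, Matrix.conjTranspose_sub, Matrix.conjTranspose_mul,
      Matrix.conjTranspose_one, Matrix.sub_mul, Matrix.mul_sub, Matrix.add_mul, Matrix.mul_add,
      Matrix.mul_one, Matrix.one_mul, Matrix.mul_assoc]
    abel
  rw [expand A, expand (lmmse X C F), ← h1, ← h2]
  simp only [Matrix.conjTranspose_sub, Matrix.sub_mul, Matrix.mul_sub, Matrix.mul_assoc]
  abel

theorem errCov_lmmse_le [DecidableEq b] [DecidableEq m] [DecidableEq n]
    (X : Matrix m n ℂ) {C : Matrix n n ℂ} (hC : C.PosSemidef)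
    (F : Matrix b m ℂ) (A : Matrix n b ℂ) :
    (errCov X C F (lmmse X C F)).trace.re ≤ (errCov X C F A).trace.re := by
  rw [errCov_eq X hC F A, Matrix.trace_add, Complex.add_re]
  have := ((obsCov_posDef X hC F).posSemidef.mul_mul_conjTranspose_same
    (A - lmmse X C F)).trace_nonneg
  have := (Complex.le_def.mp this).1
  simp only [Complex.zero_re] at this
  linarith

section Frobenius
open scoped Matrix.Norms.Frobenius

theorem re_trace_errCov [DecidableEq n]
    (X : Matrix m n ℂ) {C L : Matrix n n ℂ} (hL : L.IsHermitian)
    (hLL : L * L = C) (F : Matrix b m ℂ) (A : Matrix n b ℂ) :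
    (errCov X C F A).trace.re = ‖L - A * F * X * L‖ ^ 2 + ‖A * F‖ ^ 2 + ‖A‖ ^ 2 := by
  have : (1 - A * F * X) * C * (1 - A * F * X)ᴴ =
      (L - A * F * X * L) * (L - A * F * X * L)ᴴ := by
    have h1 : L - A * F * X * L = (1 - A * F * X) * L := by rw [Matrix.sub_mul, Matrix.one_mul]
    rw [h1, Matrix.conjTranspose_mul, hL.eq, ← hLL]
    simp only [Matrix.mul_assoc]
  simp only [Matrix.frobenius_norm_sq, errCov, this, Matrix.trace_add, Complex.add_re]

theorem norm_sq_div_le_re_trace_errCov [DecidableEq n]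
    (X : Matrix m n ℂ) {C L : Matrix n n ℂ}
    (hL : L.IsHermitian) (hLL : L * L = C) (F : Matrix b m ℂ) (A : Matrix n b ℂ) :
    ‖L‖ ^ 2 / (1 + ‖X * L‖) ^ 2 ≤ (errCov X C F A).trace.re := by
  rw [re_trace_errCov X hL hLL]
  set x := ‖L - A * F * X * L‖
  set y := ‖A * F‖
  have h1 : ‖L‖ ≤ x + y * ‖X * L‖ := by
    calc ‖L‖ = ‖(L - A * F * X * L) + (A * F) * (X * L)‖ := by
          simp [Matrix.mul_assoc]
      _ ≤ x + ‖(A * F) * (X * L)‖ := norm_add_le _ _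
      _ ≤ _ := by gcongr; exact Matrix.frobenius_norm_mul _ _
  have hx : 0 ≤ x := norm_nonneg _
  have hy : 0 ≤ y := norm_nonneg _
  have hz : 0 ≤ ‖X * L‖ := norm_nonneg _
  rw [div_le_iff₀ (by positivity)]
  have h2 : ‖L‖ ^ 2 ≤ (x + y * ‖X * L‖) ^ 2 := by gcongr
  -- Cauchy–Schwarz, followed by `1 + z² ≤ (1 + z)²` for `z ≥ 0`.
  have h3 : (x + y * ‖X * L‖) ^ 2 ≤ (x ^ 2 + y ^ 2) * (1 + ‖X * L‖) ^ 2 := by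
    have : 0 ≤ x * y := by positivity
    nlinarith [sq_nonneg (x * ‖X * L‖ - y), mul_nonneg (sq_nonneg x) hz,
      mul_nonneg (sq_nonneg y) hz]
  have h4 : 0 ≤ ‖A‖ ^ 2 * (1 + ‖X * L‖) ^ 2 := by positivity
  nlinarith

theorem exists_pos_le_re_trace_errCov [DecidableEq n]
    {C L : Matrix n n ℂ} (hL : L.IsHermitian)
    (hLL : L * L = C) (hb : Fintype.card b < C.rank) :
    ∃ c : ℝ, 0 < c ∧ ∀ (X : Matrix m n ℂ) (F : Matrix b m ℂ) (A : Matrix n b ℂ),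
      c ≤ (errCov X C F A).trace.re := by
  obtain ⟨c, hc, h⟩ := L.exists_pos_forall_rank_lt_le_norm_sub
  refine ⟨c ^ 2, by positivity, fun X F A => ?_⟩
  rw [re_trace_errCov X hL hLL]
  have h1 : (A * F * X * L).rank < L.rank := by
    rw [Matrix.rank_of_isHermitian_of_mul_self hL hLL]
    refine lt_of_le_of_lt ?_ hb
    rw [Matrix.mul_assoc, Matrix.mul_assoc]
    exact (Matrix.rank_mul_le_left _ _).trans (Matrix.rank_le_card_width _)
  have h2 : c ^ 2 ≤ ‖L - A * F * X * L‖ ^ 2 := by gcongr; exact h _ h1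
  nlinarith [sq_nonneg ‖A * F‖, sq_nonneg ‖A‖]

end Frobenius

end TKL

/-! ### Singular value decomposition -/

namespace TKL

theorem of_orthonormalBasis_mem_unitaryGroup {k : ℕ}
    (u : OrthonormalBasis (Fin k) ℂ (EuclideanSpace ℂ (Fin k))) :
    Matrix.of (fun i j => u j i) ∈ Matrix.unitaryGroup (Fin k) ℂ := by
  have := (EuclideanSpace.basisFun (Fin k) ℂ).toMatrix_orthonormalBasis_mem_unitary u
  convert this using 1
  ext i j
  simp [Module.Basis.toMatrix_apply]

/-- Take for `Q` an eigenbasis of `T* T`. The images `T q_j` are orthogonal with norms `σ j`;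
normalizing the nonzero ones and completing to an orthonormal basis gives `U`. -/
theorem exists_isSVD {m n : ℕ} (A : Matrix (Fin m) (Fin n) ℂ) : ∃ U S Q, IsSVD A U S Q := by
  set T := Matrix.toEuclideanLin A with hT
  have hn : Module.finrank ℂ (EuclideanSpace ℂ (Fin n)) = n := by simp
  set q := T.isSymmetric_adjoint_comp_self.eigenvectorBasis hn with hq
  set σ : ℕ → ℝ := fun i => T.singularValues i with hσ
  set ρ := Module.finrank ℂ (LinearMap.range T) with hρ
  have hρm : ρ ≤ m := by simpa using T.range.finrank_le
  have hρn : ρ ≤ n := by simpa [hn] using T.finrank_range_le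
  have hinner : ∀ i j, inner ℂ (T (q i)) (T (q j)) = if i = j then ((σ j : ℂ)) ^ 2 else 0 := by
    intro i j
    rw [← LinearMap.adjoint_inner_right]
    have h1 : T.adjoint (T (q j)) = ((σ j : ℂ) ^ 2) • q j := by
      have := T.isSymmetric_adjoint_comp_self.apply_eigenvectorBasis hn j
      rw [← T.sq_singularValues_fin hn j] at this
      rw [LinearMap.comp_apply] at this
      exact this.trans (by push_cast; rfl)
    rw [h1, inner_smul_right, q.inner_eq_ite]
    split_ifs <;> simp
  have hpos : ∀ i, i < ρ → 0 < σ i := fun i hi => T.singularValues_pos_iff_lt_finrank_range.mpr hi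
  have hzero : ∀ i, ρ ≤ i → σ i = 0 := fun i hi =>
    T.singularValues_eq_zero_iff_le_finrank_range.mpr hi
  -- Only indices below the rank `ρ` are used, so the inverse of a zero singular value and the
  -- default `0` play no role.
  set v : Fin m → EuclideanSpace ℂ (Fin m) :=
    fun i => if h : (i : ℕ) < n then ((σ i : ℂ))⁻¹ • T (q ⟨i, h⟩) else 0 with hv
  have hon : Orthonormal ℂ (Set.domRestrict {i : Fin m | (i : ℕ) < ρ} v) := by
    rw [orthonormal_iff_ite]
    rintro ⟨i, hi⟩ ⟨j, hj⟩
    simp only [Set.mem_ofPred_eq] at hi hj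
    have hi' : (i : ℕ) < n := hi.trans_le hρn
    have hj' : (j : ℕ) < n := hj.trans_le hρn
    have hne : (σ j : ℂ) ≠ 0 := by exact_mod_cast (hpos j hj).ne'
    simp only [Set.domRestrict_apply, hv, hi', hj', dif_pos, inner_smul_left, inner_smul_right,
      hinner, Fin.mk.injEq, Subtype.mk.injEq, ← Fin.ext_iff]
    split_ifs with h
    · subst h
      simp only [map_inv₀, Complex.conj_ofReal]
      field_simp
    · simp
  obtain ⟨u, hu⟩ := hon.exists_orthonormalBasis_extension_of_card_eq (by simp)
  have hTq : ∀ j : Fin n, ∀ k : Fin m, T (q j) k =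
      ∑ i : Fin m, u i k * if (i : ℕ) = (j : ℕ) then (σ i : ℂ) else 0 := by
    intro j k
    by_cases hj : (j : ℕ) < ρ
    · have hjm : (j : ℕ) < m := hj.trans_le hρm
      rw [Finset.sum_eq_single ⟨j, hjm⟩]
      · have hne : (σ j : ℂ) ≠ 0 := by exact_mod_cast (hpos j hj).ne'
        rw [hu ⟨j, hjm⟩ hj]
        simp [hv, hne, mul_comm]
      · intro b _ hb
        rw [if_neg (fun h => hb (Fin.ext h)), mul_zero]
      · simp
    · have h0 : T (q j) = 0 := by
        rw [← inner_self_eq_zero (𝕜 := ℂ), hinner, hzero j (not_lt.mp hj)]; simp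
      rw [h0, Finset.sum_eq_zero]
      · simp
      · intro i _
        split_ifs with h
        · rw [h, hzero j (not_lt.mp hj)]; simp
        · simp
  refine ⟨Matrix.of fun i j => u j i,
    Matrix.of fun (i : Fin m) (j : Fin n) => if (i : ℕ) = (j : ℕ) then (σ i : ℂ) else 0,
    Matrix.of fun i j => q j i, of_orthonormalBasis_mem_unitaryGroup u,
    of_orthonormalBasis_mem_unitaryGroup q,
    ⟨σ, T.singularValues_antitone, T.singularValues_nonneg, rfl⟩, ?_⟩
  have hQ := Matrix.mem_unitaryGroup_iff.mp (of_orthonormalBasis_mem_unitaryGroup q)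
  rw [Matrix.star_eq_conjTranspose] at hQ
  have hAQ : A * Matrix.of (fun i j => q j i) = Matrix.of (fun i j => u j i) *
      Matrix.of fun (i : Fin m) (j : Fin n) => if (i : ℕ) = (j : ℕ) then (σ i : ℂ) else 0 := by
    ext k j
    simp only [Matrix.mul_apply, Matrix.of_apply]
    rw [← hTq j k]
    simp [hT, Matrix.toLpLin_apply, Matrix.mulVec, dotProduct]
  rw [← hAQ, Matrix.mul_assoc, hQ, Matrix.mul_one]

/-- In a singular value decomposition of a matrix of rank at most `b`, the selection of the first
`b` left singular vectors keeps the Gram matrix. -/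
theorem IsSVD.gram_selection {b m n : ℕ} {A : Matrix (Fin m) (Fin n) ℂ}
    {U : Matrix (Fin m) (Fin m) ℂ} {S : Matrix (Fin m) (Fin n) ℂ} {Q : Matrix (Fin n) (Fin n) ℂ}
    (hA : IsSVD A U S Q) (hb : A.rank ≤ b) :
    (selection b m * Uᴴ * A)ᴴ * (selection b m * Uᴴ * A) = Aᴴ * A := by
  obtain ⟨hU, hQ, ⟨σ, hanti, hσ0, rfl⟩, rfl⟩ := hA
  set S : Matrix (Fin m) (Fin n) ℂ :=
    Matrix.of fun (i : Fin m) (j : Fin n) => if (i : ℕ) = (j : ℕ) then (σ i : ℂ) else 0 with hS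
  have hU1 : Uᴴ * U = 1 := Matrix.mem_unitaryGroup_iff'.mp hU
  have hQ1 : Qᴴ * Q = 1 := Matrix.mem_unitaryGroup_iff'.mp hQ
  have hSrank : S.rank ≤ b := by
    have : S = Uᴴ * (U * S * Qᴴ) * Q := by
      rw [Matrix.mul_assoc, Matrix.mul_assoc, hQ1, Matrix.mul_one, ← Matrix.mul_assoc, hU1,
        Matrix.one_mul]
    rw [this]
    exact (Matrix.rank_mul_le_left _ _).trans ((Matrix.rank_mul_le_right _ _).trans hb)
  -- By monotonicity, `σ k > 0` would make the leading block of size `k + 1` an invertible diagonal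
  -- matrix, of rank exceeding `b`.
  have hσz : ∀ k, b ≤ k → k < m → k < n → σ k = 0 := by
    intro k hk hkm hkn
    by_contra hne
    have hkpos : 0 < σ k := lt_of_le_of_ne (hσ0 k) (Ne.symm hne)
    have h1 := (Matrix.rank_submatrix_le S (Fin.castLE (n := k + 1) hkm)
      (Fin.castLE (n := k + 1) hkn)).trans hSrank
    have h2 : S.submatrix (Fin.castLE (n := k + 1) hkm) (Fin.castLE (n := k + 1) hkn) =
        Matrix.diagonal fun i : Fin (k + 1) => (σ i : ℂ) := by
      ext i j
      simp [hS, Matrix.diagonal_apply, Fin.ext_iff]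
    rw [h2, Matrix.rank_diagonal] at h1
    have h3 : Fintype.card {i : Fin (k + 1) // ((σ i : ℝ) : ℂ) ≠ 0} = k + 1 := by
      rw [Fintype.card_subtype, Finset.filter_true_of_mem]
      · simp
      · intro i _
        exact_mod_cast (hkpos.trans_le (hanti (Nat.lt_succ_iff.mp i.2))).ne'
    omega
  have hsel : (selection b m)ᴴ * (selection b m * S) = S := by
    ext i j
    simp only [Matrix.mul_apply, Matrix.conjTranspose_apply, selection, Matrix.of_apply]
    by_cases hi : (i : ℕ) < b
    · rw [Finset.sum_eq_single ⟨i, hi⟩, Finset.sum_eq_single i]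
      · simp
      · intro c _ hc
        simp [Fin.ext_iff.not.mp (Ne.symm hc)]
      · simp
      · intro c _ hc
        rw [if_neg (fun h => hc (Fin.ext h))]; simp
      · simp
    · rw [Finset.sum_eq_zero]
      · simp only [hS, Matrix.of_apply]
        split_ifs with h
        · rw [hσz i (not_lt.mp hi) i.2 (h ▸ j.2)]; simp
        · rfl
      · intro c _
        rw [if_neg (by omega)]; simp
  have h1 : selection b m * Uᴴ * (U * S * Qᴴ) = selection b m * S * Qᴴ := by
    calc _ = selection b m * (Uᴴ * U) * S * Qᴴ := by simp only [Matrix.mul_assoc]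
      _ = _ := by rw [hU1, Matrix.mul_one]
  rw [h1]
  calc (selection b m * S * Qᴴ)ᴴ * (selection b m * S * Qᴴ)
      = Q * Sᴴ * ((selection b m)ᴴ * (selection b m * S)) * Qᴴ := by
        simp only [Matrix.conjTranspose_mul, Matrix.conjTranspose_conjTranspose, Matrix.mul_assoc]
    _ = Q * Sᴴ * (Uᴴ * U) * S * Qᴴ := by rw [hsel, hU1, Matrix.mul_one]
    _ = _ := by
        simp only [Matrix.conjTranspose_mul, Matrix.conjTranspose_conjTranspose, Matrix.mul_assoc]

end TKL

/-! ### Second moments -/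

namespace TKL

theorem measurable_complex_mk : Measurable (fun p : ℝ × ℝ => (⟨p.1, p.2⟩ : ℂ)) :=
  Complex.measurableEquivRealProd.symm.measurable

theorem memLp_id_complexGaussian (v : ℝ≥0) : MemLp id 2 (complexGaussian v) := by
  rw [complexGaussian, memLp_map_measure_iff (by fun_prop) measurable_complex_mk.aemeasurable]
  have h1 := ((memLp_id_gaussianReal (μ := 0) (v := v / 2) 2).comp_measurePreserving
    (measurePreserving_fst (μ := gaussianReal 0 (v / 2)) (ν := gaussianReal 0 (v / 2)))).ofReal
      (K := ℂ)
  have h2 := ((memLp_id_gaussianReal (μ := 0) (v := v / 2) 2).comp_measurePreserving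
    (measurePreserving_snd (μ := gaussianReal 0 (v / 2)) (ν := gaussianReal 0 (v / 2)))).ofReal
      (K := ℂ)
  convert h1.add (h2.mul_const Complex.I) using 1
  · funext p
    simp [Complex.ext_iff]
  · norm_num

theorem integral_id_complexGaussian (v : ℝ≥0) : ∫ z, z ∂(complexGaussian v) = 0 := by
  have hint : Integrable id (complexGaussian v) := by
    rw [← memLp_one_iff_integrable]
    have : IsProbabilityMeasure (complexGaussian v) :=
      Measure.isProbabilityMeasure_map measurable_complex_mk.aemeasurable
    exact (memLp_id_complexGaussian v).mono_exponent (by norm_num)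
  have hre : ∫ z, Complex.re z ∂(complexGaussian v) = 0 := by
    rw [complexGaussian, integral_map measurable_complex_mk.aemeasurable (by fun_prop)]
    simp only
    rw [integral_fun_fst (f := fun x : ℝ => x)]
    simp
  have him : ∫ z, Complex.im z ∂(complexGaussian v) = 0 := by
    rw [complexGaussian, integral_map measurable_complex_mk.aemeasurable (by fun_prop)]
    simp only
    rw [integral_fun_snd (f := fun x : ℝ => x)]
    simp
  apply Complex.ext
  · exact (integral_re hint).symm.trans hre
  · exact (integral_im hint).symm.trans him

theorem integral_norm_sq_complexGaussian (v : ℝ≥0) :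
    ∫ z, ‖z‖ ^ 2 ∂(complexGaussian v) = v := by
  have hsq : ∫ x, x ^ 2 ∂(gaussianReal 0 (v / 2)) = v / 2 := by
    have := variance_id_gaussianReal (μ := 0) (v := v / 2)
    rw [variance_of_integral_eq_zero (by fun_prop) (by simp)] at this
    simpa using this
  have hi : Integrable (fun x : ℝ => x ^ 2) (gaussianReal 0 (v / 2)) := by
    simpa using (memLp_id_gaussianReal (μ := 0) (v := v / 2) 2).integrable_sq
  rw [complexGaussian, integral_map measurable_complex_mk.aemeasurable (by fun_prop)]
  simp only [← Complex.normSq_eq_norm_sq, Complex.normSq_mk, ← sq]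
  rw [integral_add (hi.comp_fst _) (hi.comp_snd _), integral_fun_fst (f := fun x : ℝ => x ^ 2),
    integral_fun_snd (f := fun x : ℝ => x ^ 2), hsq]
  simp

section CrossCov

variable {Ω : Type*} [MeasurableSpace Ω] {μ : Measure Ω}
  {ι κ l : Type*}

theorem memLp_mulVec [Fintype ι] (A : Matrix l ι ℂ) {Z : Ω → ι → ℂ}
    (hZ : ∀ i, MemLp (fun ω => Z ω i) 2 μ) (j : l) : MemLp (fun ω => (A *ᵥ Z ω) j) 2 μ := by
  simp only [Matrix.mulVec, dotProduct]
  exact memLp_finsetSum _ fun i _ => (hZ i).const_mul _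

theorem integrable_mul_star {f g : Ω → ℂ} (hf : MemLp f 2 μ) (hg : MemLp g 2 μ) :
    Integrable (fun ω => f ω * star (g ω)) μ :=
  hf.integrable_mul hg.star

theorem conjTranspose_crossCov (A : Ω → ι → ℂ) (B : Ω → κ → ℂ) :
    (crossCov μ A B)ᴴ = crossCov μ B A := by
  ext i j
  simp only [crossCov, Matrix.conjTranspose_apply, Matrix.of_apply]
  rw [← starRingEnd_apply, ← integral_conj]
  simp [mul_comm]

theorem crossCov_mulVec_left [Fintype ι] (A : Matrix l ι ℂ) {Z : Ω → ι → ℂ} {Y : Ω → κ → ℂ}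
    (hZ : ∀ i, MemLp (fun ω => Z ω i) 2 μ) (hY : ∀ i, MemLp (fun ω => Y ω i) 2 μ) :
    crossCov μ (fun ω => A *ᵥ Z ω) Y = A * crossCov μ Z Y := by
  ext i j
  simp only [crossCov, Matrix.mul_apply, Matrix.of_apply, Matrix.mulVec, dotProduct,
    Finset.sum_mul, mul_assoc]
  rw [integral_finsetSum _ fun k _ => (integrable_mul_star (hZ k) (hY j)).const_mul _]
  simp_rw [integral_const_mul]

theorem crossCov_mulVec_right [Fintype κ] (A : Matrix l κ ℂ) {Z : Ω → ι → ℂ} {Y : Ω → κ → ℂ}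
    (hZ : ∀ i, MemLp (fun ω => Z ω i) 2 μ) (hY : ∀ i, MemLp (fun ω => Y ω i) 2 μ) :
    crossCov μ Z (fun ω => A *ᵥ Y ω) = crossCov μ Z Y * Aᴴ := by
  rw [← conjTranspose_crossCov, crossCov_mulVec_left A hY hZ, Matrix.conjTranspose_mul,
    conjTranspose_crossCov]

theorem crossCov_add_left {Z Z' : Ω → ι → ℂ} {Y : Ω → κ → ℂ}
    (hZ : ∀ i, MemLp (fun ω => Z ω i) 2 μ) (hZ' : ∀ i, MemLp (fun ω => Z' ω i) 2 μ)
    (hY : ∀ i, MemLp (fun ω => Y ω i) 2 μ) :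
    crossCov μ (fun ω => Z ω + Z' ω) Y = crossCov μ Z Y + crossCov μ Z' Y := by
  ext i j
  simp only [crossCov, Matrix.add_apply, Matrix.of_apply, Pi.add_apply, add_mul]
  exact integral_add (integrable_mul_star (hZ i) (hY j)) (integrable_mul_star (hZ' i) (hY j))

theorem crossCov_add_right {Z : Ω → ι → ℂ} {Y Y' : Ω → κ → ℂ}
    (hZ : ∀ i, MemLp (fun ω => Z ω i) 2 μ) (hY : ∀ i, MemLp (fun ω => Y ω i) 2 μ)
    (hY' : ∀ i, MemLp (fun ω => Y' ω i) 2 μ) :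
    crossCov μ Z (fun ω => Y ω + Y' ω) = crossCov μ Z Y + crossCov μ Z Y' := by
  rw [← conjTranspose_crossCov, crossCov_add_left hY hY' hZ, Matrix.conjTranspose_add,
    conjTranspose_crossCov, conjTranspose_crossCov]

theorem integral_sum_norm_sq [Fintype ι] {Z : Ω → ι → ℂ} (hZ : ∀ i, MemLp (fun ω => Z ω i) 2 μ) :
    ∫ ω, ∑ i, ‖Z ω i‖ ^ 2 ∂μ = (crossCov μ Z Z).trace.re := by
  rw [integral_finsetSum _ fun i _ => (hZ i).norm.integrable_sq]
  simp only [Matrix.trace, Complex.re_sum, Matrix.diag_apply, crossCov, Matrix.of_apply]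
  refine Finset.sum_congr rfl fun i _ => ?_
  rw [← RCLike.re_eq_complex_re, ← integral_re (integrable_mul_star (hZ i) (hZ i))]
  congr 1
  funext ω
  simp [Complex.normSq_apply, ← Complex.normSq_eq_norm_sq]

theorem crossCov_eq_zero_of_indepFun {Z : Ω → ι → ℂ} {Y : Ω → κ → ℂ}
    (hind : IndepFun Z Y μ) (hZ : ∀ i, MemLp (fun ω => Z ω i) 2 μ)
    (hY : ∀ i, MemLp (fun ω => Y ω i) 2 μ) (h0 : ∀ i, ∫ ω, Z ω i ∂μ = 0) :
    crossCov μ Z Y = 0 := by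
  ext i j
  simp only [crossCov, Matrix.of_apply, Matrix.zero_apply]
  have hij : IndepFun (fun ω => Z ω i) (fun ω => star (Y ω j)) μ :=
    hind.comp (φ := fun z : ι → ℂ => z i) (ψ := fun y : κ → ℂ => star (y j))
      (measurable_pi_apply i) (by fun_prop)
  rw [hij.integral_fun_mul_eq_mul_integral (hZ i).1 (hY j).star.1, h0, zero_mul]

/-- Polarization over `ℂ`; no Hermitian symmetry is needed. -/
theorem eq_of_forall_star_dotProduct_mulVec_eq [Fintype ι] [DecidableEq ι] {A B : Matrix ι ι ℂ}
    (h : ∀ t : ι → ℂ, star t ⬝ᵥ (A *ᵥ t) = star t ⬝ᵥ (B *ᵥ t)) : A = B := by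
  apply (Matrix.toEuclideanLin (𝕜 := ℂ)).injective
  rw [← ext_inner_map]
  intro x
  have h1 := congrArg star (h x.ofLp)
  have h2 : ∀ M : Matrix ι ι ℂ, x.ofLp ⬝ᵥ star (M *ᵥ x.ofLp) =
      star (star x.ofLp ⬝ᵥ M *ᵥ x.ofLp) := by
    intro M
    simp [dotProduct, Pi.star_apply]
  simpa only [EuclideanSpace.inner_eq_star_dotProduct, Matrix.toLpLin_apply, h2] using h1

namespace IsCN

variable [Fintype ι] {Z : Ω → ι → ℂ} {C : Matrix ι ι ℂ}

theorem memLp (hZ : IsCN μ Z C) (i : ι) : MemLp (fun ω => Z ω i) 2 μ := by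
  classical
  have h := hZ.2 (Pi.single i 1)
  have h1 : (fun ω => star (Pi.single i (1 : ℂ)) ⬝ᵥ Z ω) = fun ω => Z ω i := by
    funext ω; simp
  rw [h1] at h
  have hm : AEMeasurable (fun ω => Z ω i) μ := (measurable_pi_apply i).comp_aemeasurable hZ.1
  have h2 := memLp_id_complexGaussian (star (Pi.single i (1 : ℂ)) ⬝ᵥ
    (C *ᵥ Pi.single i 1)).re.toNNReal
  rw [← h, memLp_map_measure_iff (by fun_prop) hm] at h2
  exact h2

theorem integral_eq_zero (hZ : IsCN μ Z C) (i : ι) : ∫ ω, Z ω i ∂μ = 0 := by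
  classical
  have h := hZ.2 (Pi.single i 1)
  have h1 : (fun ω => star (Pi.single i (1 : ℂ)) ⬝ᵥ Z ω) = fun ω => Z ω i := by
    funext ω; simp
  rw [h1] at h
  have hm : AEMeasurable (fun ω => Z ω i) μ := (measurable_pi_apply i).comp_aemeasurable hZ.1
  have h2 := integral_id_complexGaussian (star (Pi.single i (1 : ℂ)) ⬝ᵥ
    (C *ᵥ Pi.single i 1)).re.toNNReal
  rw [← h, integral_map hm (by fun_prop)] at h2
  exact h2

/-- The scalar laws give the second moment of each `tᴴ Z`, and these determine the matrix by
polarization. Positivity of `C` ensures that `toNNReal` does not truncate the variance. -/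
theorem crossCov_self [DecidableEq ι] (hZ : IsCN μ Z C) (hC : C.PosSemidef) :
    crossCov μ Z Z = C := by
  apply eq_of_forall_star_dotProduct_mulVec_eq
  intro t
  have hm : AEMeasurable (fun ω => star t ⬝ᵥ Z ω) μ := by
    have : Measurable (fun z : ι → ℂ => star t ⬝ᵥ z) := by
      simp only [dotProduct]; fun_prop
    exact this.comp_aemeasurable hZ.1
  have h1 := integral_norm_sq_complexGaussian (star t ⬝ᵥ (C *ᵥ t)).re.toNNReal
  rw [← hZ.2 t, integral_map hm (by fun_prop)] at h1
  have hnn := hC.dotProduct_mulVec_nonneg t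
  rw [Real.coe_toNNReal _ (Complex.le_def.mp hnn).1] at h1
  have h2 : star t ⬝ᵥ (C *ᵥ t) = ((star t ⬝ᵥ (C *ᵥ t)).re : ℂ) :=
    Complex.ext (by simp) (by simpa using (Complex.le_def.mp hnn).2.symm)
  rw [h2, ← h1, ← integral_complex_ofReal]
  have hA := crossCov_mulVec_left (Matrix.of fun (_ : Unit) i => star (t i)) hZ.memLp hZ.memLp
  have hB := crossCov_mulVec_right (Matrix.of fun (_ : Unit) i => star (t i))
    (memLp_mulVec (Matrix.of fun (_ : Unit) i => star (t i)) hZ.memLp) hZ.memLp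
  rw [hA] at hB
  have hR : ∀ D : Matrix ι ι ℂ, (Matrix.of (fun (_ : Unit) i => star (t i)) * D *
      (Matrix.of fun (_ : Unit) i => star (t i))ᴴ) () () = star t ⬝ᵥ (D *ᵥ t) := by
    intro D
    rw [Matrix.mul_assoc]
    simp [Matrix.mul_apply, Matrix.mulVec, dotProduct]
  rw [← hR, ← hB]
  simp only [crossCov, Matrix.of_apply]
  congr 1
  funext ω
  exact (Complex.mul_conj' _).trans (by push_cast; rfl)

end IsCN

end CrossCov

end TKL

/-! ### The error and the transmit power in terms of covariances -/

namespace TKL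

/-- The second-order description of a channel of covariance `C` and two white noises, all
uncorrelated. -/
structure IsSource {Ω : Type*} [MeasurableSpace Ω] (μ : Measure Ω) {b m n : ℕ}
    (C : Matrix (Fin n) (Fin n) ℂ) (h : Ω → Fin n → ℂ) (ntr : Ω → Fin m → ℂ)
    (nul : Ω → Fin b → ℂ) : Prop where
  memLp_h : ∀ i, MemLp (fun ω => h ω i) 2 μ
  memLp_ntr : ∀ i, MemLp (fun ω => ntr ω i) 2 μ
  memLp_nul : ∀ i, MemLp (fun ω => nul ω i) 2 μ
  cov_h : crossCov μ h h = C
  cov_ntr : crossCov μ ntr ntr = 1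
  cov_nul : crossCov μ nul nul = 1
  cov_h_ntr : crossCov μ h ntr = 0
  cov_h_nul : crossCov μ h nul = 0
  cov_ntr_nul : crossCov μ ntr nul = 0

section

variable {Ω : Type*} [MeasurableSpace Ω] {μ : Measure Ω} {b m n : ℕ}
  {C : Matrix (Fin n) (Fin n) ℂ} {h : Ω → Fin n → ℂ} {ntr : Ω → Fin m → ℂ} {nul : Ω → Fin b → ℂ}

theorem isSource_of_isCN (hC : C.PosSemidef) (hh : IsCN μ h C) (hntr : IsCN μ ntr 1)
    (hnul : IsCN μ nul 1) (hind1 : IndepFun h (fun ω => (ntr ω, nul ω)) μ)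
    (hind2 : IndepFun ntr nul μ) : IsSource μ C h ntr nul where
  memLp_h := hh.memLp
  memLp_ntr := hntr.memLp
  memLp_nul := hnul.memLp
  cov_h := hh.crossCov_self hC
  cov_ntr := hntr.crossCov_self Matrix.PosSemidef.one
  cov_nul := hnul.crossCov_self Matrix.PosSemidef.one
  cov_h_ntr := crossCov_eq_zero_of_indepFun (hind1.comp measurable_id measurable_fst)
    hh.memLp hntr.memLp hh.integral_eq_zero
  cov_h_nul := crossCov_eq_zero_of_indepFun (hind1.comp measurable_id measurable_snd)
    hh.memLp hnul.memLp hh.integral_eq_zero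
  cov_ntr_nul := crossCov_eq_zero_of_indepFun hind2 hntr.memLp hnul.memLp hntr.integral_eq_zero

/-- The linear map from training measurement to codeword. -/
noncomputable def encoder (b : ℕ) {m : ℕ} (U : Matrix (Fin m) (Fin m) ℂ) (a : Fin b → ℝ) :
    Matrix (Fin b) (Fin m) ℂ :=
  Matrix.diagonal (fun i => ((Real.sqrt (a i) : ℝ) : ℂ)) * selection b m * Uᴴ

namespace IsSource

variable (hs : IsSource μ C h ntr nul)
include hs

/-- Second moments of linear combinations of the channel and the noises. -/
theorem crossCov_linear {k l : Type*} [Fintype k] [Fintype l]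
    (A : Matrix k (Fin n) ℂ) (B : Matrix k (Fin m) ℂ) (D : Matrix k (Fin b) ℂ)
    (A' : Matrix l (Fin n) ℂ) (B' : Matrix l (Fin m) ℂ) (D' : Matrix l (Fin b) ℂ) :
    crossCov μ (fun ω => A *ᵥ h ω + B *ᵥ ntr ω + D *ᵥ nul ω)
      (fun ω => A' *ᵥ h ω + B' *ᵥ ntr ω + D' *ᵥ nul ω) =
      A * C * A'ᴴ + B * B'ᴴ + D * D'ᴴ := by
  have c1 : crossCov μ ntr h = 0 := by
    rw [← conjTranspose_crossCov, hs.cov_h_ntr, Matrix.conjTranspose_zero]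
  have c2 : crossCov μ nul h = 0 := by
    rw [← conjTranspose_crossCov, hs.cov_h_nul, Matrix.conjTranspose_zero]
  have c3 : crossCov μ nul ntr = 0 := by
    rw [← conjTranspose_crossCov, hs.cov_ntr_nul, Matrix.conjTranspose_zero]
  have hA := memLp_mulVec A hs.memLp_h
  have hB := memLp_mulVec B hs.memLp_ntr
  have hD := memLp_mulVec D hs.memLp_nul
  have hA' := memLp_mulVec A' hs.memLp_h
  have hB' := memLp_mulVec B' hs.memLp_ntr
  have hD' := memLp_mulVec D' hs.memLp_nul
  have hAB' : ∀ i, MemLp (fun ω => (A' *ᵥ h ω + B' *ᵥ ntr ω) i) 2 μ :=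
    fun i => (hA' i).add (hB' i)
  have hABD' : ∀ i, MemLp (fun ω => (A' *ᵥ h ω + B' *ᵥ ntr ω + D' *ᵥ nul ω) i) 2 μ :=
    fun i => (hAB' i).add (hD' i)
  rw [crossCov_add_left (Z := fun ω => A *ᵥ h ω + B *ᵥ ntr ω) (fun i => (hA i).add (hB i)) hD
    hABD', crossCov_add_left hA hB hABD', crossCov_mulVec_left A hs.memLp_h hABD',
    crossCov_mulVec_left B hs.memLp_ntr hABD', crossCov_mulVec_left D hs.memLp_nul hABD']
  have key : ∀ {j : ℕ} (Z : Ω → Fin j → ℂ), (∀ i, MemLp (fun ω => Z ω i) 2 μ) →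
      crossCov μ Z (fun ω => A' *ᵥ h ω + B' *ᵥ ntr ω + D' *ᵥ nul ω) =
        crossCov μ Z h * A'ᴴ + crossCov μ Z ntr * B'ᴴ + crossCov μ Z nul * D'ᴴ := by
    intro j Z hZ
    rw [crossCov_add_right (Y := fun ω => A' *ᵥ h ω + B' *ᵥ ntr ω) hZ hAB' hD',
      crossCov_add_right hZ hA' hB', crossCov_mulVec_right A' hZ hs.memLp_h,
      crossCov_mulVec_right B' hZ hs.memLp_ntr, crossCov_mulVec_right D' hZ hs.memLp_nul]
  rw [key h hs.memLp_h, key ntr hs.memLp_ntr, key nul hs.memLp_nul, hs.cov_h, hs.cov_ntr,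
    hs.cov_nul, hs.cov_h_ntr, hs.cov_h_nul, hs.cov_ntr_nul, c1, c2, c3]
  simp [Matrix.mul_assoc]

theorem memLp_linear {k : Type*} (A : Matrix k (Fin n) ℂ) (B : Matrix k (Fin m) ℂ)
    (D : Matrix k (Fin b) ℂ) (i : k) :
    MemLp (fun ω => (A *ᵥ h ω + B *ᵥ ntr ω + D *ᵥ nul ω) i) 2 μ :=
  ((memLp_mulVec A hs.memLp_h i).add (memLp_mulVec B hs.memLp_ntr i)).add
    (memLp_mulVec D hs.memLp_nul i)

variable (X : Matrix (Fin m) (Fin n) ℂ) (U : Matrix (Fin m) (Fin m) ℂ) (a : Fin b → ℝ)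

theorem power_eq : ∫ ω, ∑ i, ‖codeword X h ntr U a ω i‖ ^ 2 ∂μ =
    (encoder b U a * (X * C * Xᴴ + 1) * (encoder b U a)ᴴ).trace.re := by
  have h1 : codeword X h ntr U a = fun ω => (encoder b U a * X) *ᵥ h ω +
      encoder b U a *ᵥ ntr ω + (0 : Matrix (Fin b) (Fin b) ℂ) *ᵥ nul ω := by
    funext ω
    simp [codeword, received, encoder, Matrix.mulVec_add, Matrix.mulVec_mulVec]
  rw [h1, integral_sum_norm_sq (hs.memLp_linear _ _ _), hs.crossCov_linear]
  simp [Matrix.mul_add, Matrix.add_mul, Matrix.conjTranspose_mul, Matrix.mul_assoc]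

theorem mse_eq : mse μ X h ntr nul U a =
    (errCov X C (encoder b U a) (lmmse X C (encoder b U a))).trace.re := by
  set F := encoder b U a with hF
  have h1 : feedback X h ntr nul U a = fun ω => (F * X) *ᵥ h ω +
      F *ᵥ ntr ω + (1 : Matrix (Fin b) (Fin b) ℂ) *ᵥ nul ω := by
    funext ω
    simp [feedback, codeword, received, hF, encoder, Matrix.mulVec_add, Matrix.mulVec_mulVec]
  have h2 : h = fun ω => (1 : Matrix (Fin n) (Fin n) ℂ) *ᵥ h ω +
      (0 : Matrix (Fin n) (Fin m) ℂ) *ᵥ ntr ω + (0 : Matrix (Fin n) (Fin b) ℂ) *ᵥ nul ω := by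
    funext ω; simp
  have h3 : crossCov μ h (feedback X h ntr nul U a) *
      (crossCov μ (feedback X h ntr nul U a) (feedback X h ntr nul U a))⁻¹ = lmmse X C F := by
    have e1 : crossCov μ h (feedback X h ntr nul U a) = C * Xᴴ * Fᴴ := by
      rw [h1]
      nth_rewrite 1 [h2]
      rw [hs.crossCov_linear]
      simp [Matrix.conjTranspose_mul, Matrix.mul_assoc]
    have e2 : crossCov μ (feedback X h ntr nul U a) (feedback X h ntr nul U a) =
        obsCov X C F := by
      rw [h1, hs.crossCov_linear]
      simp [obsCov, Matrix.mul_add, Matrix.add_mul, Matrix.conjTranspose_mul, Matrix.mul_assoc]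
    rw [e1, e2, lmmse]
  set A := lmmse X C F
  -- The error is linear in the channel and the two noises, which are uncorrelated; its covariance
  -- is therefore the sum of the three terms of `errCov`.
  have h4 : (fun ω => h ω - estimate μ X h ntr nul U a ω) = fun ω => (1 - A * F * X) *ᵥ h ω +
      (-(A * F)) *ᵥ ntr ω + (-A) *ᵥ nul ω := by
    funext ω
    rw [estimate, h3, h1]
    simp only [Matrix.mulVec_add, Matrix.mulVec_mulVec, Matrix.sub_mulVec,
      Matrix.neg_mulVec, Matrix.one_mulVec, Matrix.mul_assoc]
    abel
  have h5 : mse μ X h ntr nul U a =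
      ∫ ω, ∑ i, ‖(fun ω => h ω - estimate μ X h ntr nul U a ω) ω i‖ ^ 2 ∂μ := rfl
  rw [h5, h4, integral_sum_norm_sq (hs.memLp_linear _ _ _), hs.crossCov_linear]
  simp [errCov]

end IsSource

end

end TKL

/-! ### Existence of designs -/

namespace TKL

theorem selection_mul_conjTranspose_self {b m : ℕ} (hb : b ≤ m) :
    selection b m * (selection b m)ᴴ = 1 := by
  ext i j
  simp only [Matrix.mul_apply, Matrix.conjTranspose_apply, selection, Matrix.of_apply,
    Matrix.one_apply]
  rw [Finset.sum_eq_single ⟨i, i.2.trans_le hb⟩]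
  · by_cases hij : i = j
    · simp [hij]
    · simp [hij, Fin.ext_iff.not.mp (Ne.symm hij)]
  · intro c _ hc
    rw [if_neg (fun h => hc (Fin.ext h.symm)), zero_mul]
  · simp

theorem selection_mul_unitary {b m : ℕ} (hb : b ≤ m) {U : Matrix (Fin m) (Fin m) ℂ}
    (hU : U ∈ Matrix.unitaryGroup (Fin m) ℂ) :
    (selection b m * Uᴴ) * (selection b m * Uᴴ)ᴴ = 1 := by
  have hU1 : Uᴴ * U = 1 := Matrix.mem_unitaryGroup_iff'.mp hU
  rw [Matrix.conjTranspose_mul, Matrix.conjTranspose_conjTranspose, Matrix.mul_assoc,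
    ← Matrix.mul_assoc Uᴴ, hU1, Matrix.one_mul, selection_mul_conjTranspose_self hb]

/-- The power gain of each codeword coordinate. -/
noncomputable def powerGain (b : ℕ) {m n : ℕ} (X : Matrix (Fin m) (Fin n) ℂ)
    (C : Matrix (Fin n) (Fin n) ℂ) (U : Matrix (Fin m) (Fin m) ℂ) (i : Fin b) : ℝ :=
  (((selection b m * Uᴴ) * (X * C * Xᴴ + 1) * (selection b m * Uᴴ)ᴴ :
    Matrix (Fin b) (Fin b) ℂ) i i).re

/-- By cyclicity of the trace the square roots enter only through `Dᴴ D = diag(a)`, so the power is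
linear in the allocation. -/
theorem re_trace_encoder {b m n : ℕ} (X : Matrix (Fin m) (Fin n) ℂ)
    (C : Matrix (Fin n) (Fin n) ℂ) (U : Matrix (Fin m) (Fin m) ℂ) {a : Fin b → ℝ}
    (ha : ∀ i, 0 ≤ a i) :
    (encoder b U a * (X * C * Xᴴ + 1) * (encoder b U a)ᴴ).trace.re =
      ∑ i, a i * powerGain b X C U i := by
  set D := Matrix.diagonal (fun i => ((Real.sqrt (a i) : ℝ) : ℂ)) with hD
  have hDD : Dᴴ * D = Matrix.diagonal (fun i => (a i : ℂ)) := by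
    rw [hD, Matrix.diagonal_conjTranspose, Matrix.diagonal_mul_diagonal]
    congr 1
    funext i
    simp only [Pi.star_apply, Complex.star_def, Complex.conj_ofReal]
    rw [← Complex.ofReal_mul, Real.mul_self_sqrt (ha i)]
  have h1 : encoder b U a = D * (selection b m * Uᴴ) := by rw [encoder, Matrix.mul_assoc]
  have h2 : encoder b U a * (X * C * Xᴴ + 1) * (encoder b U a)ᴴ =
      D * ((selection b m * Uᴴ) * (X * C * Xᴴ + 1) * (selection b m * Uᴴ)ᴴ) * Dᴴ := by
    rw [h1, Matrix.conjTranspose_mul]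
    simp only [Matrix.mul_assoc]
  rw [h2, Matrix.trace_mul_comm, ← Matrix.mul_assoc, hDD]
  simp [Matrix.trace, Matrix.diagonal_mul, powerGain]

/-- The rows of `S Uᴴ` are orthonormal, so the downlink noise alone contributes `1`. This keeps the
feasible set bounded even in directions without channel gain. -/
theorem one_le_powerGain {b m n : ℕ} (hb : b ≤ m) (X : Matrix (Fin m) (Fin n) ℂ)
    {C : Matrix (Fin n) (Fin n) ℂ} (hC : C.PosSemidef) {U : Matrix (Fin m) (Fin m) ℂ}
    (hU : U ∈ Matrix.unitaryGroup (Fin m) ℂ) (i : Fin b) : 1 ≤ powerGain b X C U i := by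
  rw [powerGain, Matrix.mul_add, Matrix.add_mul, Matrix.mul_one, selection_mul_unitary hb hU,
    Matrix.add_apply, Matrix.one_apply_eq, Complex.add_re, Complex.one_re]
  have := (((hC.mul_mul_conjTranspose_same X).mul_mul_conjTranspose_same
    (selection b m * Uᴴ)).diag_nonneg (i := i))
  have := (Complex.le_def.mp this).1
  simp only [Complex.zero_re] at this
  linarith

theorem continuous_re_trace_errCov_encoder {b m n : ℕ} (X : Matrix (Fin m) (Fin n) ℂ)
    {C : Matrix (Fin n) (Fin n) ℂ} (hC : C.PosSemidef) (U : Matrix (Fin m) (Fin m) ℂ) :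
    Continuous fun a : Fin b → ℝ =>
      (errCov X C (encoder b U a) (lmmse X C (encoder b U a))).trace.re := by
  have hF : Continuous fun a : Fin b → ℝ => encoder b U a := by
    unfold encoder
    fun_prop
  have hV : Continuous fun a : Fin b → ℝ => obsCov X C (encoder b U a) := by
    unfold obsCov
    fun_prop
  have hVi : Continuous fun a : Fin b → ℝ => (obsCov X C (encoder b U a))⁻¹ := by
    rw [continuous_iff_continuousAt]
    intro a
    refine ContinuousAt.comp (f := fun a : Fin b → ℝ => obsCov X C (encoder b U a))
      (g := fun V => V⁻¹) (continuousAt_matrix_inv _ ?_) hV.continuousAt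
    -- The uplink noise keeps `obsCov` positive definite for every `a`, so inversion is continuous
    -- along the whole family.
    have hdet := (Matrix.isUnit_iff_isUnit_det _).mp (obsCov_posDef X hC (encoder b U a)).isUnit
    rw [Ring.inverse_eq_inv']
    exact continuousAt_inv₀ hdet.ne_zero
  have hA : Continuous fun a : Fin b → ℝ => lmmse X C (encoder b U a) := by
    unfold lmmse
    fun_prop
  unfold errCov
  fun_prop

namespace IsSource

variable {Ω : Type*} [MeasurableSpace Ω] {μ : Measure Ω} {b m n : ℕ}
  {C : Matrix (Fin n) (Fin n) ℂ} {h : Ω → Fin n → ℂ} {ntr : Ω → Fin m → ℂ} {nul : Ω → Fin b → ℂ}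

theorem feasible_iff (hs : IsSource μ C h ntr nul) (X : Matrix (Fin m) (Fin n) ℂ) (P : ℝ)
    (U : Matrix (Fin m) (Fin m) ℂ) (a : Fin b → ℝ) :
    Feasible μ X h ntr P U a ↔ (∀ i, 0 ≤ a i) ∧ ∑ i, a i * powerGain b X C U i ≤ P := by
  unfold Feasible
  refine and_congr_right fun ha => ?_
  rw [hs.power_eq, re_trace_encoder X C U ha]

theorem exists_isDesign (hs : IsSource μ C h ntr nul) (hC : C.PosSemidef) (hb : b ≤ m)
    (X : Matrix (Fin m) (Fin n) ℂ) {P : ℝ} (hP : 0 ≤ P) :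
    ∃ U a, IsDesign μ X C h ntr nul P U a := by
  obtain ⟨U, S, Q, hsvd⟩ := exists_isSVD (X * CFC.sqrt C)
  have hU := hsvd.1
  have hcomp : IsCompact {a : Fin b → ℝ | Feasible μ X h ntr P U a} := by
    refine (isCompact_Icc (a := (0 : Fin b → ℝ)) (b := fun _ => P)).of_isClosed_subset ?_ ?_
    · simp only [hs.feasible_iff, Set.ofPred_and, Set.ofPred_forall]
      refine (isClosed_iInter fun i => isClosed_le continuous_const (continuous_apply i)).inter
        (isClosed_le (by fun_prop) continuous_const)
    · intro a ha
      have ha' := (hs.feasible_iff X P U a).mp ha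
      refine ⟨ha'.1, fun i => le_trans ?_ ha'.2⟩
      have h1 : ∀ j, 0 ≤ a j * powerGain b X C U j := fun j =>
        mul_nonneg (ha'.1 j) (zero_le_one.trans (one_le_powerGain hb X hC hU j))
      calc a i ≤ a i * powerGain b X C U i :=
            le_mul_of_one_le_right (ha'.1 i) (one_le_powerGain hb X hC hU i)
        _ ≤ _ := Finset.single_le_sum (f := fun j => a j * powerGain b X C U j)
            (fun j _ => h1 j) (Finset.mem_univ i)
  have hne : {a : Fin b → ℝ | Feasible μ X h ntr P U a}.Nonempty :=
    ⟨0, (hs.feasible_iff X P U 0).mpr ⟨fun _ => le_rfl, by simpa using hP⟩⟩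
  obtain ⟨a, ha, hmin⟩ := hcomp.exists_isMinOn hne
    (continuous_re_trace_errCov_encoder X hC U).continuousOn
  refine ⟨U, a, ⟨S, Q, hsvd⟩, ha, fun a' ha' => ?_⟩
  rw [hs.mse_eq, hs.mse_eq]
  exact hmin ha'

end IsSource

end TKL

/-! ### Random pilots resolve the channel almost surely -/

/-- Induction with Fubini: for almost all values of the other variables the leading coefficient in
the first variable is nonzero, and then the finitely many roots form a null set for an atomless
measure. -/
theorem MvPolynomial.ae_eval_ne_zero_pi {n : ℕ} (ν : Fin n → Measure ℂ)
    [∀ i, IsProbabilityMeasure (ν i)] [∀ i, NullSingletonClass (ν i)] {p : MvPolynomial (Fin n) ℂ}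
    (hp : p ≠ 0) : ∀ᵐ x ∂(Measure.pi ν), MvPolynomial.eval x p ≠ 0 := by
  induction n with
  | zero =>
    refine Eventually.of_forall fun x => ?_
    obtain ⟨c, rfl⟩ := MvPolynomial.C_surjective (Fin 0) p
    simpa using hp
  | succ n ih =>
    set q := MvPolynomial.finSuccEquiv ℂ n p with hq
    have hq0 : q ≠ 0 := by simpa [hq] using hp
    have h1 := ih (fun i => ν i.succ) (p := q.leadingCoeff) (by simpa using hq0)
    set s : Set (ℂ × (Fin n → ℂ)) :=
      {z | Polynomial.eval z.1 (q.map (MvPolynomial.eval z.2)) = 0} with hs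
    have hmeas : MeasurableSet s := by
      have hs' : s = {z | MvPolynomial.eval (Fin.cons z.1 z.2 : Fin (n + 1) → ℂ) p = 0} := by
        ext z
        simp only [hs, Set.mem_ofPred_eq, MvPolynomial.eval_eq_eval_mv_eval', hq]
      rw [hs']
      have hc : Continuous fun z : ℂ × (Fin n → ℂ) => (Fin.cons z.1 z.2 : Fin (n + 1) → ℂ) := by
        refine continuous_pi fun i => ?_
        refine Fin.cases ?_ (fun j => ?_) i
        · simpa using continuous_fst
        · simpa [Function.comp_def] using (continuous_apply j).comp continuous_snd
      exact (isClosed_eq ((MvPolynomial.continuous_eval p).comp hc)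
        continuous_const).measurableSet
    have hnull : ((ν 0).prod (Measure.pi fun i : Fin n => ν i.succ)) s = 0 := by
      rw [Measure.prod_apply_symm hmeas,
        lintegral_eq_zero_iff (measurable_measure_prodMk_right hmeas)]
      filter_upwards [h1] with y hy
      have hne : q.map (MvPolynomial.eval y) ≠ 0 := by
        intro h0
        apply hy
        have := congrArg (fun r => Polynomial.coeff r q.natDegree) h0
        simpa using this
      exact ((Polynomial.finite_setOfPred_isRoot hne).measure_zero (ν 0))
    have hmp := measurePreserving_piFinSuccAbove (fun i : Fin (n + 1) => ν i) 0
    have h2 := hmp.measure_preimage hmeas.nullMeasurableSet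
    simp only [Fin.zero_succAbove] at h2
    rw [hnull] at h2
    rw [ae_iff]
    convert h2 using 2
    ext x
    simp only [ne_eq, not_not, Set.mem_ofPred_eq, hs, Set.mem_preimage]
    rw [hq, ← MvPolynomial.eval_eq_eval_mv_eval']
    simp

theorem MvPolynomial.ae_eval_ne_zero {σ Ω : Type*} [Finite σ] [MeasurableSpace Ω]
    {μ : Measure Ω} [IsProbabilityMeasure μ] {Z : σ → Ω → ℂ} (hZ : ∀ i, AEMeasurable (Z i) μ)
    (hna : ∀ i, NullSingletonClass (μ.map (Z i))) (hind : iIndepFun Z μ)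
    {p : MvPolynomial σ ℂ} (hp : p ≠ 0) :
    ∀ᵐ ω ∂μ, MvPolynomial.eval (fun i => Z i ω) p ≠ 0 := by
  obtain ⟨k, ⟨e⟩⟩ := Finite.exists_equiv_fin σ
  have hind' : iIndepFun (fun j => Z (e.symm j)) μ := hind.precomp e.symm.injective
  have hmap := (iIndepFun_iff_map_fun_eq_pi_map fun j => hZ (e.symm j)).mp hind'
  have : ∀ j, IsProbabilityMeasure (μ.map (Z (e.symm j))) := fun j =>
    Measure.isProbabilityMeasure_map (hZ _)
  have h1 := MvPolynomial.ae_eval_ne_zero_pi (fun j => μ.map (Z (e.symm j)))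
    (p := MvPolynomial.rename e p)
    (fun h0 => hp (MvPolynomial.rename_injective e e.injective (by simpa using h0)))
  rw [← hmap] at h1
  have h2 := ae_of_ae_map (aemeasurable_pi_lambda _ fun j => hZ (e.symm j)) h1
  filter_upwards [h2] with ω hω
  rw [MvPolynomial.eval_rename] at hω
  simpa [Function.comp_def] using hω

namespace TKL

theorem nullSingletonClass_complexGaussian {v : ℝ≥0} (hv : v ≠ 0) :
    NullSingletonClass (complexGaussian v) := by
  have : NullSingletonClass (gaussianReal 0 (v / 2)) :=
    nullSingletonClass_gaussianReal (by simpa using hv)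
  refine ⟨fun z => ?_⟩
  rw [complexGaussian, Measure.map_apply measurable_complex_mk (measurableSet_singleton z)]
  have : (fun p : ℝ × ℝ => (⟨p.1, p.2⟩ : ℂ)) ⁻¹' {z} = {(z.re, z.im)} := by
    ext p
    simp [Complex.ext_iff, Prod.ext_iff]
  rw [this]
  exact measure_singleton _

theorem ae_resolves {N Np Tp M : ℕ} (probed : Fin Np ↪ Fin N)
    {C : Matrix (Fin (N * M)) (Fin (N * M)) ℂ} (hres : Resolves Tp probed C)
    {Ω : Type*} [MeasurableSpace Ω] {μ : Measure Ω} [IsProbabilityMeasure μ]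
    {W : Ω → Fin Np → Matrix (Fin Tp) (Fin M) ℂ}
    (hW : ∀ ℓ i j, AEMeasurable (fun x => W x ℓ i j) μ)
    (hna : ∀ ℓ i j, NullSingletonClass (μ.map fun x => W x ℓ i j))
    (hind : iIndepFun (fun (q : Fin Np × Fin Tp × Fin M) (x : Ω) => W x q.1 q.2.1 q.2.2) μ) :
    ∀ᵐ x ∂μ, ∀ v, pilotMatrix probed (W x) *ᵥ (C *ᵥ v) = 0 → C *ᵥ v = 0 := by
  obtain ⟨W₀, hW₀⟩ := hres
  obtain ⟨R, hR⟩ := Matrix.exists_mul_eq_of_ker_le (pilotMatrix probed W₀ * C) C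
    (fun v hv => hW₀ v (by rwa [Matrix.mulVec_mulVec]))
  obtain ⟨J, hJ⟩ := C.exists_mul_mul_self_eq
  obtain ⟨B, hB⟩ : ∃ B, B = J * R := ⟨_, rfl⟩
  obtain ⟨D, hD⟩ : ∃ D, D = 1 - J * C := ⟨_, rfl⟩
  let σ := Fin Np × Fin Tp × Fin M
  let Y : Matrix (Fin (Np * Tp)) (Fin (N * M)) (MvPolynomial σ ℂ) := Matrix.of fun i j =>
    if probed (finProdFinEquiv.symm i).1 = (finProdFinEquiv.symm j).1 then
      MvPolynomial.X ((finProdFinEquiv.symm i).1, (finProdFinEquiv.symm i).2,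
        (finProdFinEquiv.symm j).2)
    else 0
  -- With `C J C = C` and `R X₀ C = C` for the resolving pilots `X₀`, the matrix `(1 - J C) + J R X
  -- C` equals the identity at `X = X₀`, so its determinant is a nonzero polynomial in the pilot
  -- symbols.
  let p : MvPolynomial σ ℂ := (D.map (MvPolynomial.C (σ := σ)) +
    B.map (MvPolynomial.C (σ := σ)) * Y * C.map (MvPolynomial.C (σ := σ))).det
  have heval : ∀ w : Fin Np → Matrix (Fin Tp) (Fin M) ℂ,
      MvPolynomial.eval (fun q : σ => w q.1 q.2.1 q.2.2) p =
        (D + B * pilotMatrix probed w * C).det := by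
    intro w
    set φ := MvPolynomial.eval (fun q : σ => w q.1 q.2.1 q.2.2)
    have hφC : ∀ {k l : Type} (A : Matrix k l ℂ), (A.map MvPolynomial.C).map φ = A := by
      intro k l A
      ext i j
      simp [φ]
    have hY : Y.map φ = pilotMatrix probed w := by
      ext i j
      simp only [Y, Matrix.map_apply, Matrix.of_apply, pilotMatrix]
      split_ifs <;> simp [φ]
    rw [show p = Matrix.det _ from rfl, RingHom.map_det, RingHom.mapMatrix_apply,
      Matrix.map_add φ (map_add φ), Matrix.map_mul, Matrix.map_mul, hφC, hφC, hφC, hY]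
  have hp : p ≠ 0 := by
    intro h0
    have h1 := heval W₀
    rw [h0, map_zero, hB, hD, Matrix.mul_assoc, Matrix.mul_assoc, hR] at h1
    simp at h1
  filter_upwards [MvPolynomial.ae_eval_ne_zero (fun q : σ => hW q.1 q.2.1 q.2.2)
    (fun q => hna q.1 q.2.1 q.2.2) hind hp] with x hx v hv
  rw [heval, hB, hD] at hx
  have h1 : C *ᵥ (J *ᵥ (C *ᵥ v)) = C *ᵥ v := by
    rw [Matrix.mulVec_mulVec, Matrix.mulVec_mulVec, hJ]
  -- If `X C v = 0`, then `J C v` lies in the kernel of this matrix, since both `1 - J C` and `X C`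
  -- annihilate it. Nonsingularity gives `J C v = 0`, hence `C v = C J C v = 0`.
  have h2 : ((1 - J * C) + J * R * pilotMatrix probed (W x) * C) *ᵥ (J *ᵥ (C *ᵥ v)) = 0 := by
    rw [Matrix.add_mulVec, Matrix.sub_mulVec, Matrix.one_mulVec, ← Matrix.mulVec_mulVec, h1,
      ← Matrix.mulVec_mulVec, h1, ← Matrix.mulVec_mulVec, hv]
    simp
  have h3 := Matrix.eq_zero_of_mulVec_eq_zero hx h2
  rw [← h1, h3, Matrix.mulVec_zero]

end TKL

/-! ### Scaling of the error with the downlink SNR -/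

namespace TKL

section Frobenius
open scoped Matrix.Norms.Frobenius

theorem norm_sqrt_smul_mul {m n k : ℕ} (X : Matrix (Fin m) (Fin n) ℂ) (L : Matrix (Fin n) (Fin k) ℂ)
    (s : ℝ) : ‖((√s : ℝ) : ℂ) • X * L‖ = √s * ‖X * L‖ := by
  rw [Matrix.smul_mul, norm_smul, Complex.norm_real, Real.norm_of_nonneg (Real.sqrt_nonneg s)]

theorem exists_pos_div_le_re_trace_errCov {b m n : ℕ} (X : Matrix (Fin m) (Fin n) ℂ)
    {C L : Matrix (Fin n) (Fin n) ℂ} (hL : L.IsHermitian) (hLL : L * L = C) (hC0 : C ≠ 0) :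
    ∃ c : ℝ, 0 < c ∧ ∀ s : ℝ, 1 ≤ s → ∀ (F : Matrix (Fin b) (Fin m) ℂ)
      (A : Matrix (Fin n) (Fin b) ℂ), c / s ≤ (errCov (((√s : ℝ) : ℂ) • X) C F A).trace.re := by
  have hL0 : 0 < ‖L‖ := norm_pos_iff.mpr fun h => hC0 (by rw [← hLL, h, Matrix.zero_mul])
  have hx : 0 ≤ ‖X * L‖ := norm_nonneg _
  refine ⟨‖L‖ ^ 2 / (1 + ‖X * L‖) ^ 2, by positivity, fun s hs F A => ?_⟩
  refine le_trans ?_ (norm_sq_div_le_re_trace_errCov _ hL hLL F A)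
  rw [norm_sqrt_smul_mul, div_div]
  have h1 : 1 ≤ √s := Real.one_le_sqrt.mpr hs
  have h2 : (1 + √s * ‖X * L‖) ^ 2 ≤ (1 + ‖X * L‖) ^ 2 * s := by
    calc (1 + √s * ‖X * L‖) ^ 2 ≤ (√s * (1 + ‖X * L‖)) ^ 2 := by gcongr; linarith
      _ = _ := by rw [mul_pow, Real.sq_sqrt (by linarith), mul_comm]
  gcongr

theorem re_trace_errCov_lmmse_le {b m n : ℕ} (X : Matrix (Fin m) (Fin n) ℂ)
    {C : Matrix (Fin n) (Fin n) ℂ} (hC : C.PosSemidef) (F : Matrix (Fin b) (Fin m) ℂ) :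
    (errCov X C F (lmmse X C F)).trace.re ≤ C.trace.re := by
  refine (errCov_lmmse_le X hC F 0).trans (le_of_eq ?_)
  simp [errCov]

theorem exists_re_trace_errCov_le {b m n : ℕ} (X : Matrix (Fin m) (Fin n) ℂ)
    {C L : Matrix (Fin n) (Fin n) ℂ} (hL : L.IsHermitian) (hLL : L * L = C)
    (hres : ∀ v, X *ᵥ (C *ᵥ v) = 0 → C *ᵥ v = 0) (hb : b ≤ m) (hrank : C.rank ≤ b)
    {ρ : ℝ} (hρ : 0 < ρ) :
    ∃ c t : ℝ, 0 < t ∧ ∀ s : ℝ, 1 ≤ s → ∀ U S Q, IsSVD (((√s : ℝ) : ℂ) • X * L) U S Q →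
      ∑ i, t * powerGain b (((√s : ℝ) : ℂ) • X) C U i ≤ ρ * s ∧
      ∃ A, (errCov (((√s : ℝ) : ℂ) • X) C (encoder b U fun _ => t) A).trace.re ≤ c / s := by
  set G := (X * L)ᴴ * (X * L) with hG
  -- It suffices that `ker G = ker (X L)` lies in `ker L`. As `C = Lᴴ L`, the matrices `C` and `L`
  -- have the same kernel, hence `L = C R'ᴴ`, and `hres` applies to vectors `L v`.
  obtain ⟨R, hR⟩ : ∃ R, R * G = L := by
    obtain ⟨R', hR'⟩ := Matrix.exists_mul_eq_of_ker_le C L fun v hv => by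
      rw [← hLL, ← hL.eq] at hv
      nth_rewrite 2 [hL.eq] at hv
      exact Matrix.conjTranspose_mul_self_mulVec_eq_zero _ _ |>.mp hv
    have hCh : C.IsHermitian := by
      rw [Matrix.IsHermitian, ← hLL, Matrix.conjTranspose_mul, hL.eq]
    have hLC : L = C * R'ᴴ := by
      rw [← hL.eq, ← hR', Matrix.conjTranspose_mul, hCh.eq]
    refine Matrix.exists_mul_eq_of_ker_le G L fun v hv => ?_
    have h1 : (X * L) *ᵥ v = 0 := (Matrix.conjTranspose_mul_self_mulVec_eq_zero _ _).mp hv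
    rw [hLC, ← Matrix.mulVec_mulVec]
    apply hres
    rwa [Matrix.mulVec_mulVec, Matrix.mulVec_mulVec, Matrix.mul_assoc, ← hLC]
  have hx : 0 ≤ ‖X * L‖ := norm_nonneg _
  -- The constant allocation uses power at most `t b (s ‖X L‖² + 1)`, which this choice keeps below
  -- `ρ s` for `s ≥ 1`. It depends neither on `s` nor on `U`.
  set t : ℝ := ρ / ((b + 1) * (‖X * L‖ ^ 2 + 1)) with ht
  have htpos : 0 < t := by positivity
  set c₀ : ℝ := (R * G * Rᴴ).trace.re with hc₀
  refine ⟨c₀ + c₀ / t, t, htpos, fun s hs U S Q hsvd => ?_⟩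
  have hs0 : 0 < s := by linarith
  have hss : 0 < √s := Real.sqrt_pos.mpr hs0
  have hst : 0 < √t := Real.sqrt_pos.mpr htpos
  have hssC : ((√s : ℝ) : ℂ) ≠ 0 := by exact_mod_cast hss.ne'
  have hstC : ((√t : ℝ) : ℂ) ≠ 0 := by exact_mod_cast hst.ne'
  set E := selection b m * Uᴴ with hE
  have hEE : E * Eᴴ = 1 := selection_mul_unitary hb hsvd.1
  have hEnorm : ‖E‖ ^ 2 = b := by
    rw [Matrix.frobenius_norm_sq, hEE]; simp
  have hF : encoder b U (fun _ => t) = ((√t : ℝ) : ℂ) • E := by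
    rw [encoder, Matrix.mul_assoc, ← hE, ← Matrix.smul_eq_diagonal_mul]
  have hgram : (E * (X * L))ᴴ * (E * (X * L)) = G := by
    have hr : (((√s : ℝ) : ℂ) • X * L).rank ≤ b := by
      refine (Matrix.rank_mul_le_right _ _).trans ?_
      rwa [Matrix.rank_of_isHermitian_of_mul_self hL hLL]
    have h1 := hsvd.gram_selection hr
    rw [← hE] at h1
    simp only [Matrix.smul_mul, Matrix.mul_smul, Matrix.conjTranspose_smul, smul_smul] at h1
    exact smul_right_injective _ (mul_ne_zero hssC (star_ne_zero.mpr hssC)) h1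
  constructor
  · have hsum : ∑ i, powerGain b (((√s : ℝ) : ℂ) • X) C U i =
        ‖E * (((√s : ℝ) : ℂ) • X * L)‖ ^ 2 + ‖E‖ ^ 2 := by
      have h1 : E * (((√s : ℝ) : ℂ) • X * C * (((√s : ℝ) : ℂ) • X)ᴴ + 1) * Eᴴ =
          (E * (((√s : ℝ) : ℂ) • X * L)) * (E * (((√s : ℝ) : ℂ) • X * L))ᴴ + E * Eᴴ := by
        rw [Matrix.mul_add, Matrix.add_mul, Matrix.mul_one,
          Matrix.conjTranspose_mul E (((√s : ℝ) : ℂ) • X * L), Matrix.conjTranspose_mul _ L,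
          hL.eq, ← hLL]
        simp only [Matrix.mul_assoc]
      rw [Matrix.frobenius_norm_sq, Matrix.frobenius_norm_sq, ← Complex.add_re,
        ← Matrix.trace_add, ← h1]
      simp [Matrix.trace, powerGain, hE]
    rw [← Finset.mul_sum, hsum, hEnorm]
    have h2 : ‖E * (((√s : ℝ) : ℂ) • X * L)‖ ^ 2 ≤ b * (s * ‖X * L‖ ^ 2) := by
      calc _ ≤ (‖E‖ * ‖((√s : ℝ) : ℂ) • X * L‖) ^ 2 := by
            gcongr; exact Matrix.frobenius_norm_mul _ _
        _ = _ := by rw [norm_sqrt_smul_mul, mul_pow, mul_pow, hEnorm, Real.sq_sqrt hs0.le]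
    have hb0 : (0 : ℝ) ≤ b := Nat.cast_nonneg b
    calc t * (‖E * (((√s : ℝ) : ℂ) • X * L)‖ ^ 2 + b)
        ≤ t * (((b + 1) * (‖X * L‖ ^ 2 + 1)) * s) := by
          gcongr
          nlinarith [sq_nonneg ‖X * L‖, mul_nonneg (sq_nonneg ‖X * L‖) hs0.le,
            mul_nonneg hb0 (sub_nonneg.mpr hs)]
      _ = ρ * s := by rw [ht]; field_simp
  -- Zero forcing: Gram preservation gives `A₀ (E X L) = R G = L`. The norms of `A₀` and `A₀ E`
  -- depend only on `R G Rᴴ`, hence not on `U`. Rescaling by `1 / (√s √t)` leaves the noise terms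
  -- `c₀ / s` and `c₀ / (t s)`.
  · set A₀ := R * (E * (X * L))ᴴ with hA₀
    have hA₀L : A₀ * (E * (X * L)) = L := by rw [hA₀, Matrix.mul_assoc, hgram, hR]
    have hA₀n : ‖A₀‖ ^ 2 = c₀ := by
      rw [Matrix.frobenius_norm_sq, hc₀, ← hgram, hA₀, Matrix.conjTranspose_mul R,
        Matrix.conjTranspose_conjTranspose]
      simp only [Matrix.mul_assoc]
    have hA₀E : ‖A₀ * E‖ ^ 2 = c₀ := by
      rw [← hA₀n, Matrix.frobenius_norm_sq, Matrix.frobenius_norm_sq, Matrix.conjTranspose_mul,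
        Matrix.mul_assoc, ← Matrix.mul_assoc E, hEE, Matrix.one_mul]
    set A := (((√s : ℝ) : ℂ)⁻¹ * ((√t : ℝ) : ℂ)⁻¹) • A₀ with hA
    have hAF : A * encoder b U (fun _ => t) = ((√s : ℝ) : ℂ)⁻¹ • (A₀ * E) := by
      rw [hA, hF, Matrix.smul_mul, Matrix.mul_smul, smul_smul]
      congr 1
      field_simp
    have hAFXL : A * encoder b U (fun _ => t) * (((√s : ℝ) : ℂ) • X) * L = L := by
      rw [hAF, Matrix.smul_mul, Matrix.mul_smul, smul_smul, inv_mul_cancel₀ hssC, one_smul]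
      simpa only [Matrix.mul_assoc] using hA₀L
    refine ⟨A, le_of_eq ?_⟩
    rw [re_trace_errCov _ hL hLL, hAFXL, sub_self, norm_zero, hAF, hA, norm_smul, norm_smul,
      mul_pow, mul_pow, hA₀E, hA₀n, norm_mul, norm_inv, norm_inv, Complex.norm_real,
      Complex.norm_real, Real.norm_of_nonneg hss.le, Real.norm_of_nonneg hst.le, mul_pow, inv_pow,
      inv_pow, Real.sq_sqrt hs0.le, Real.sq_sqrt htpos.le]
    field_simp
    ring

end Frobenius

end TKL

/-! ### Combining the bounds for almost every pilot realization -/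

theorem theorem1
    -- numbers of antennas, subcarriers, probed subcarriers, pilot symbols per probed subcarrier,
    -- users, and the feedback dimension; the training dimension is `Np * Tp`
    (M N Np Tp K bfb : ℕ) (hK : 1 ≤ K) (hKM : K ≤ M) (hfb : bfb ≤ Np * Tp)
    (probed : Fin Np ↪ Fin N)
    -- multiuser efficiency
    (κ : ℝ) (hκ0 : 0 < κ) (hκ1 : κ ≤ 1)
    -- channel covariance
    (C : Matrix (Fin (N * M)) (Fin (N * M)) ℂ) (hC : C.PosSemidef) (hC0 : C ≠ 0)
    (hres : C.rank ≤ bfb → TKL.Resolves Tp probed C)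
    -- normalized random pilot symbols: i.i.d. `CN(0, 1 / M)`
    {ΩX : Type*} [MeasurableSpace ΩX] (PX : Measure ΩX) [IsProbabilityMeasure PX]
    (W : ΩX → Fin Np → Matrix (Fin Tp) (Fin M) ℂ)
    (hWlaw : ∀ ℓ i j, HasLaw (fun x => W x ℓ i j) (TKL.complexGaussian (1 / (M : ℝ≥0))) PX)
    (hWindep : iIndepFun (fun (q : Fin Np × Fin Tp × Fin M) (x : ΩX) => W x q.1 q.2.1 q.2.2) PX)
    -- channel, downlink noise and uplink noise: independent complex Gaussian vectors
    {Ω : Type*} [MeasurableSpace Ω] (P : Measure Ω) [IsProbabilityMeasure P]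
    (h : Ω → Fin (N * M) → ℂ) (ntr : Ω → Fin (Np * Tp) → ℂ) (nul : Ω → Fin bfb → ℂ)
    (hh : TKL.IsCN P h C) (hntr : TKL.IsCN P ntr 1) (hnul : TKL.IsCN P nul 1)
    (hind1 : IndepFun h (fun ω => (ntr ω, nul ω)) P) (hind2 : IndepFun ntr nul P) :
    ∀ᵐ x ∂PX,
      -- the scheme is well defined at every SNR
      (∀ snr : ℝ, 0 < snr → ∃ U a,
        TKL.IsDesign P (TKL.scaledPilot probed (W x) snr) C h ntr nul
          (TKL.uplinkPower bfb M K κ snr) U a) ∧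
      -- and, however it is chosen, its error has the stated order
      ∀ (U : ℝ → Matrix (Fin (Np * Tp)) (Fin (Np * Tp)) ℂ) (a : ℝ → Fin bfb → ℝ),
        (∀ snr : ℝ, 0 < snr →
          TKL.IsDesign P (TKL.scaledPilot probed (W x) snr) C h ntr nul
            (TKL.uplinkPower bfb M K κ snr) (U snr) (a snr)) →
        (fun snr : ℝ => TKL.mse P (TKL.scaledPilot probed (W x) snr) h ntr nul (U snr) (a snr))
          =Θ[atTop] (fun snr : ℝ => snr ^ (-(if C.rank ≤ bfb then (1 : ℝ) else 0))) := by

  have hM : 0 < M := hK.trans hKM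
  have hsrc := TKL.isSource_of_isCN hC hh hntr hnul hind1 hind2
  have hres' : ∀ᵐ x ∂PX, C.rank ≤ bfb →
      ∀ v, TKL.pilotMatrix probed (W x) *ᵥ (C *ᵥ v) = 0 → C *ᵥ v = 0 := by
    by_cases hr : C.rank ≤ bfb
    · filter_upwards [TKL.ae_resolves probed (hres hr) (fun ℓ i j => (hWlaw ℓ i j).aemeasurable)
        (fun ℓ i j => by
          rw [(hWlaw ℓ i j).map_eq]
          exact TKL.nullSingletonClass_complexGaussian (by positivity)) hWindep] with x hx _
      exact hx
    · exact Eventually.of_forall fun x h => absurd h hr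
  filter_upwards [hres'] with x hx
  have hpow : ∀ snr : ℝ, TKL.uplinkPower bfb M K κ snr = (bfb * κ * M / K) * snr := by
    intro snr
    rw [TKL.uplinkPower]; ring
  refine ⟨fun snr hsnr => hsrc.exists_isDesign hC hfb _ ?_, fun U a hdesign => ?_⟩
  · rw [hpow]; positivity
  set X := TKL.pilotMatrix probed (W x)
  have hX : ∀ snr, TKL.scaledPilot probed (W x) snr = ((√snr : ℝ) : ℂ) • X := fun _ => rfl
  have hL := Matrix.isHermitian_sqrt C
  have hLL := Matrix.sqrt_mul_sqrt hC
  obtain ⟨c, hc, hlow⟩ := TKL.exists_pos_div_le_re_trace_errCov (b := bfb) X hL hLL hC0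
  split_ifs with hr
  -- A nonzero `C` has positive rank; positivity of `bfb` makes the power slope `ρ` positive.
  · have hb0 : 0 < bfb := by
      refine lt_of_lt_of_le (Nat.pos_of_ne_zero fun h0 => hC0 ?_) hr
      have h1 := LinearMap.range_eq_bot.mp (Submodule.finrank_eq_zero.mp h0)
      exact Matrix.ext_of_mulVec_single fun j => by
        rw [Matrix.zero_mulVec]
        exact LinearMap.congr_fun h1 (Pi.single j 1)
    obtain ⟨c', t, ht, hup⟩ := TKL.exists_re_trace_errCov_le (b := bfb) X hL hLL (hx hr) hfb hr
      (ρ := bfb * κ * M / K) (by positivity)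
    constructor
    · refine Asymptotics.IsBigO.of_bound c' ?_
      filter_upwards [eventually_ge_atTop 1] with s hs
      have hs0 : 0 < s := by linarith
      obtain ⟨⟨S, Q, hsvd⟩, -, hmin⟩ := hdesign s hs0
      obtain ⟨hp, A, hA⟩ := hup s hs (U s) S Q hsvd
      -- The only use of optimality: comparison with the constant allocation.
      have h1 := hmin (fun _ => t)
        ((hsrc.feasible_iff _ _ _ _).mpr ⟨fun _ => ht.le, by rw [hpow]; exact hp⟩)
      have h2 := hlow s hs (TKL.encoder bfb (U s) (a s)) (TKL.lmmse (((√s : ℝ) : ℂ) • X) C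
        (TKL.encoder bfb (U s) (a s)))
      rw [hsrc.mse_eq, hsrc.mse_eq] at h1
      have h3 := (h1.trans (TKL.errCov_lmmse_le _ hC _ A)).trans hA
      rw [hsrc.mse_eq, Real.rpow_neg_one, Real.norm_of_nonneg, Real.norm_of_nonneg (by positivity),
        ← div_eq_mul_inv]
      · exact h3
      · exact le_trans (by positivity) h2
    · refine Asymptotics.IsBigO.of_bound c⁻¹ ?_
      filter_upwards [eventually_ge_atTop 1] with s hs
      have hs0 : 0 < s := by linarith
      have h2 := hlow s hs (TKL.encoder bfb (U s) (a s)) (TKL.lmmse (((√s : ℝ) : ℂ) • X) C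
        (TKL.encoder bfb (U s) (a s)))
      rw [hsrc.mse_eq, hX, Real.rpow_neg_one, Real.norm_of_nonneg (by positivity),
        Real.norm_of_nonneg (le_trans (by positivity) h2), inv_mul_eq_div, le_div_iff₀ hc]
      rwa [div_eq_inv_mul] at h2
  -- Below the rank, both bounds hold for every encoder with its LMMSE estimator and at every SNR,
  -- so neither the SVD nor optimality enters.
  · obtain ⟨d, hd, hlow'⟩ := TKL.exists_pos_le_re_trace_errCov (b := Fin bfb)
      (m := Fin (Np * Tp)) hL hLL (by simpa using hr)
    simp only [neg_zero, Real.rpow_zero]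
    constructor
    · refine Asymptotics.IsBigO.of_bound C.trace.re ?_
      filter_upwards with s
      rw [hsrc.mse_eq, Real.norm_of_nonneg (hd.le.trans (hlow' _ _ _)), norm_one, mul_one]
      exact TKL.re_trace_errCov_lmmse_le _ hC _
    · refine Asymptotics.IsBigO.of_bound d⁻¹ ?_
      filter_upwards with s
      rw [hsrc.mse_eq, Real.norm_of_nonneg (hd.le.trans (hlow' _ _ _)), norm_one,
        inv_mul_eq_div, le_div_iff₀ hd, one_mul]
      exact hlow' _ _ _
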